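/- A point process on $\mathbb{R}$ is a random locally finite configuration $u=(u_j)$ of points of $\mathbb{R}$, repetitions allowed (and counted with multiplicity); $\#_V(u)$ denotes the number of points of $u$ in $V$. It has uniform local moments (is u.l.m.) if for each $n\ge 1$ there is a constant $C_n<\infty$ with $\mathbb{E}\big[(\#_{[L,L+1]}(u))^n\big]\le C_n$ for all $L\in\mathbb{R}$. For $B>0$, a u.l.m. point process $v$ mimics a u.l.m. point process $u$ at the bandwidth $[-B,B]$ if for every $n\ge 1$ and every Schwartz function $\eta\in\mathcal{S}(\mathbb{R}^n)$ whose Fourier transform $\hat\eta(\xi)=\int_{\mathbb{R}^n}\eta(x)e^{-2\pi i x\cdot\xi}\,dx$ is supported in $[-B,B]^n$, $$\mathbb{E}\sum_{j_1,\dots,j_n\ \mathrm{distinct}}\eta(u_{j_1},\dots,u_{j_n})=\mathbb{E}\sum_{j_1,\dots,j_n\ \mathrm{distinct}}\eta(v_{j_1},\dots,v_{j_n}).$$ The sine process $z$ is the point process on $\mathbb{R}$ whose correlation measures are $\det_{n\times n}[S(x_i-x_j)]\,dx_1\cdots dx_n$, where $S(x)=\frac{\sin \pi x}{\pi x}$ and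 $S(0)=1$; that is, $$\mathbb{E}\sum_{j_1,\dots,j_n\ \mathrm{distinct}}\phi(z_{j_1},\dots,z_{j_n})=\int_{\mathbb{R}^n}\phi(x)\det_{n\times n}\big[S(x_i-x_j)\big]\,dx_1\cdots dx_n$$ for all $n\ge1$ and all continuous compactly supported $\phi:\mathbb{R}^n\to\mathbb{C}$. Let $a>0$. There exists a u.l.m. point process supported on the lattice $a\mathbb{Z}=\{ak: k\in\mathbb{Z}\}$ that mimics the sine process at the Nyquist bandwidth $\left[-\frac1{2a},\frac1{2a}\right]$ if and only if $a\le\frac12$. -/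

import Mathlib

namespace BandLimitedMimicry

open MeasureTheory
open scoped ENNReal NNReal FourierTransform

noncomputable section

/-- A locally finite configuration of points of `ℝ`, where points may coincide: `mult x` is the
number of points of the configuration at the position `x`. -/
@[ext]
structure Configuration where
  mult : ℝ → ℕ
  locallyFinite : ∀ K : Set ℝ, IsCompact K → {x ∈ K | mult x ≠ 0}.Finite

/-- The labels `j` of the points `u_j` of a configuration: one label for every point, counted with
multiplicity. The point with label `j` sits at the position `j.1`. -/
abbrev Configuration.Index (u : Configuration) : Type := Σ x : ℝ, Fin (u.mult x)

/-- The number `#_V(u)` of points of the configuration in `V`, counted with multiplicity. -/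
def Configuration.count (u : Configuration) (V : Set ℝ) : ℕ∞ :=
  {j : u.Index | j.1 ∈ V}.encard

/-- The σ-algebra on configurations that is generated by the cylinder sets
`{u | #_V(u) = m}`, with `V` a bounded Borel set and `m` a natural number. -/
instance instMeasurableSpaceConfiguration : MeasurableSpace Configuration :=
  MeasurableSpace.generateFrom
    {s | ∃ (V : Set ℝ) (m : ℕ), MeasurableSet V ∧ Bornology.IsBounded V ∧
      s = {u : Configuration | u.count V = m}}

/-- A point process on `ℝ`, given by its law on the space of configurations. -/
abbrev PointProcess : Type := ProbabilityMeasure Configuration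

/-- The sum of `φ (u_{j_1}, …, u_{j_n})` over all `n`-tuples of pairwise distinct labels. -/
def distinctSum {n : ℕ} (φ : EuclideanSpace ℝ (Fin n) → ℂ) (u : Configuration) : ℂ :=
  ∑' j : Fin n ↪ u.Index, φ (WithLp.toLp 2 fun i => (j i).1)

/-- Uniform local moments: for every `n ≥ 1` the `n`-th moment of the number of points in
`[L, L + 1]` is bounded uniformly in `L`. -/
def UniformLocalMoments (P : PointProcess) : Prop :=
  ∀ n : ℕ, 1 ≤ n → ∃ C : ℝ≥0, ∀ L : ℝ,
    ∫⁻ u, (u.count (Set.Icc L (L + 1)) : ℝ≥0∞) ^ n ∂(P : Measure Configuration) ≤ C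

/-- The point process is supported on the lattice `aℤ`. -/
def SupportedOnLattice (P : PointProcess) (a : ℝ) : Prop :=
  ∀ᵐ u ∂(P : Measure Configuration), ∀ x : ℝ, u.mult x ≠ 0 → ∃ k : ℤ, x = a * k

/-- `Q` mimics `P` at the bandwidth `[-B, B]`: both processes have uniform local moments, and
their correlations agree against all Schwartz functions whose Fourier transform is supported in
`[-B, B]^n`. For processes with uniform local moments the sums below converge absolutely almost
surely and are integrable random variables. -/
structure Mimics (Q P : PointProcess) (B : ℝ) : Prop where
  ulm_left : UniformLocalMoments Q
  ulm_right : UniformLocalMoments P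
  correlations_eq : ∀ n : ℕ, 1 ≤ n → ∀ η : SchwartzMap (EuclideanSpace ℝ (Fin n)) ℂ,
    Function.support (𝓕 (η : EuclideanSpace ℝ (Fin n) → ℂ)) ⊆ {ξ | ∀ i, ξ i ∈ Set.Icc (-B) B} →
    ∫ u, distinctSum η u ∂(P : Measure Configuration) =
      ∫ u, distinctSum η u ∂(Q : Measure Configuration)

/-- The function `S x = sin (π x) / (π x)`, with `S 0 = 1`. -/
def S (x : ℝ) : ℝ := Real.sinc (Real.pi * x)

/-- `P` is the sine process: for every `n ≥ 1` its `n`-level correlation measure is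
`det [S (x_i - x_j)] dx_1 ⋯ dx_n`. -/
def IsSineProcess (P : PointProcess) : Prop :=
  ∀ n : ℕ, 1 ≤ n → ∀ φ : EuclideanSpace ℝ (Fin n) → ℂ, Continuous φ → HasCompactSupport φ →
    Integrable (distinctSum φ) (P : Measure Configuration) ∧
    ∫ u, distinctSum φ u ∂(P : Measure Configuration) =
      ∫ x : EuclideanSpace ℝ (Fin n),
        φ x * (((Matrix.of fun i j : Fin n => S (x i - x j)).det : ℝ) : ℂ)

end

end BandLimitedMimicry

/-! Write `B = 1/(2a)`; the condition `a ≤ 1/2` says `B ≥ 1`.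

Sufficiency. The mimicking process is the discrete sine process on `aℤ`, determinantal with kernel
`a S(a(j - k))`. This kernel consists of the Fourier coefficients of the indicator of `(-a/2, a/2)`
inside `(-1/2, 1/2)`, so it lies between `0` and `1` as an operator once `a ≤ 1`, and such a process
exists (`exists_determinantal`). Each permutation term of `det S(x_i - x_j)` is an average of plane
waves with frequencies `t_i - t_{σ⁻¹ i}`, where `|t_i| < 1/2`; these lie in `(-1, 1)^n`, hence in
the open band cube. For `η` with spectrum in `[-B, B]^n`, Poisson summation has no aliasing there,
so the lattice sum of `η` times such a wave equals the integral (`hasSum_lattice_fourier`,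
`hasSum_lattice_sineDet`). For `a` between `1/2` and `1` the discrete process still exists, but the
frequencies leave the band.

Necessity. Let `a > 1/2`, so `B < 1`. Suppose `f` is real, has spectrum in `[-B, B]`, and is
nonnegative on `aℤ`. Testing mimicry on `∏ f(x_i)` makes every integral `∫ ∏ f(x_i) det S(x_i -
x_j)` nonnegative. With `P` the projection onto functions with frequencies in `[-1/2, 1/2]`, these
integrals are the coefficients of the Fredholm determinant `det(1 + τ P f P) = ∑ τ^n/n! ∫ ∏ f(x_i)
det S(x_i - x_j)`, which is therefore at least `1` for `τ ≥ 0`. If `P f P` had a negative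
eigenvalue, the determinant would vanish at some `τ > 0`. So a contradiction follows from an `f`
that is nonnegative on the lattice while `P f P` is not a positive operator
(`exists_integral_sineDet_neg`; trace-class theory is avoided by replacing the frequency interval
with a finite grid).

Such an `f` is a Dirichlet kernel with frequencies `-Mt, …, Mt`, damped by a nonnegative factor,
where `a t (2M+1) = 1` (`exists_lattice_nonneg_form_neg`). On `aℤ` the kernel is `0` or `2M+1`. As a
quadratic form it sees the Toeplitz symbol `1_{|k| ≤ M}`; at positions `0, 1, M+1` with weights `1,
-1, 1` this gives `3 - 2 - 2 = -1`, because the differences `1` and `M` are inside the band and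
`M+1` is outside. The positions fit in the interval of length `1` precisely because `B < 1` allows
`(M+1)t < 1`. -/

namespace BandLimitedMimicry

open MeasureTheory
open scoped ENNReal NNReal FourierTransform

noncomputable section

/-! ### Correlation identity for integrable test functions and moments of the sine process -/

section SineProcess

open Filter Topology

/-- The tuple of positions of an injective tuple of labels. -/
abbrev positions {n : ℕ} {u : Configuration} (j : Fin n ↪ u.Index) : EuclideanSpace ℝ (Fin n) :=
  WithLp.toLp 2 fun i => (j i).1

lemma finite_index_mem (u : Configuration) {K : Set ℝ} (hK : IsCompact K) :
    {j : u.Index | j.1 ∈ K}.Finite := by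
  have h := u.locallyFinite K hK
  have : {j : u.Index | j.1 ∈ K} ⊆
      ⋃ x ∈ {x ∈ K | u.mult x ≠ 0}, Set.range fun i : Fin (u.mult x) => (⟨x, i⟩ : u.Index) := by
    rintro ⟨x, i⟩ hx
    simp only [Set.mem_iUnion]
    exact ⟨x, ⟨hx, (Fin.pos i).ne'⟩, i, rfl⟩
  exact (h.biUnion fun x _ => Set.finite_range _).subset this

lemma finite_embedding_mem (u : Configuration) (n : ℕ) {K : Set ℝ} (hK : IsCompact K) :
    {j : Fin n ↪ u.Index | ∀ i, (j i).1 ∈ K}.Finite := by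
  have h : (Set.univ.pi fun _ : Fin n => {j : u.Index | j.1 ∈ K}).Finite :=
    Set.Finite.pi fun _ => finite_index_mem u hK
  refine (h.preimage (f := fun j : Fin n ↪ u.Index => (j : Fin n → u.Index))
    (DFunLike.coe_injective.injOn)).subset ?_
  intro j hj i _
  exact hj i

lemma finite_support_positions (u : Configuration) {n : ℕ} {F : Type*} [Zero F]
    {φ : EuclideanSpace ℝ (Fin n) → F} (hφ : HasCompactSupport φ) :
    (Function.support fun j : Fin n ↪ u.Index => φ (positions j)).Finite := by
  obtain ⟨r, hr⟩ := hφ.isBounded.subset_closedBall 0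
  refine (finite_embedding_mem u n (isCompact_Icc (a := -r) (b := r))).subset ?_
  intro j hj i
  have h1 : positions j ∈ Metric.closedBall (0 : EuclideanSpace ℝ (Fin n)) r :=
    hr (subset_tsupport _ hj)
  have h2 := (PiLp.norm_apply_le (positions j) i).trans (mem_closedBall_zero_iff.1 h1)
  exact abs_le.1 h2

/-- The sum of a nonnegative function over all injective tuples of labels. -/
def distinctLSum {n : ℕ} (φ : EuclideanSpace ℝ (Fin n) → ℝ≥0∞) (u : Configuration) : ℝ≥0∞ :=
  ∑' j : Fin n ↪ u.Index, φ (positions j)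

lemma distinctLSum_ofReal {n : ℕ} {φ : EuclideanSpace ℝ (Fin n) → ℝ} (h0 : ∀ x, 0 ≤ φ x)
    (hφ : HasCompactSupport φ) (u : Configuration) :
    distinctLSum (fun x => ENNReal.ofReal (φ x)) u =
      ENNReal.ofReal (distinctSum (fun x => (φ x : ℂ)) u).re := by
  have hs : Summable fun j : Fin n ↪ u.Index => φ (positions j) :=
    summable_of_hasFiniteSupport (finite_support_positions u hφ)
  unfold distinctSum distinctLSum
  rw [← Complex.ofReal_tsum, Complex.ofReal_re, ENNReal.ofReal_tsum_of_nonneg (fun _ => h0 _) hs]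

/-- The `n`-level correlation density of the sine process. -/
def sineDet {n : ℕ} (x : EuclideanSpace ℝ (Fin n)) : ℝ :=
  (Matrix.of fun i j : Fin n => S (x i - x j)).det

lemma abs_S_le (x : ℝ) : |S x| ≤ 1 := Real.abs_sinc_le_one _

lemma continuous_S : Continuous S := by
  unfold S; fun_prop

lemma continuous_sineDet {n : ℕ} : Continuous (sineDet (n := n)) := by
  unfold sineDet
  refine Continuous.matrix_det (continuous_matrix fun i j => ?_)
  exact continuous_S.comp (by fun_prop)

lemma abs_sineDet_le {n : ℕ} (x : EuclideanSpace ℝ (Fin n)) : |sineDet x| ≤ n.factorial := by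
  have := Matrix.det_le (A := Matrix.of fun i j : Fin n => S (x i - x j))
    (abv := AbsoluteValue.abs) (x := 1) (fun i j => abs_S_le _)
  simpa [sineDet] using this

/-- The correlation density is bounded by `n!`, since each of the `n!` terms of the determinant has
modulus at most `1`. Measurability of the sum is inherited from the integrability contained in
`IsSineProcess`. -/
lemma lintegral_distinctLSum {z : PointProcess} (hz : IsSineProcess z) {n : ℕ} (hn : 1 ≤ n)
    {φ : EuclideanSpace ℝ (Fin n) → ℝ} (h0 : ∀ x, 0 ≤ φ x) (hc : Continuous φ)
    (hφ : HasCompactSupport φ) :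
    AEMeasurable (distinctLSum fun x => ENNReal.ofReal (φ x)) (z : Measure Configuration) ∧
    ∫⁻ u, distinctLSum (fun x => ENNReal.ofReal (φ x)) u ∂(z : Measure Configuration) ≤
      ENNReal.ofReal (n.factorial * ∫ x, φ x) := by
  have hφ' : HasCompactSupport fun x => (φ x : ℂ) := hφ.comp_left (g := fun x : ℝ => (x : ℂ)) rfl
  obtain ⟨hi, he⟩ := hz n hn (fun x => (φ x : ℂ)) (by fun_prop) hφ'
  simp_rw [funext (distinctLSum_ofReal h0 hφ)]
  have hre : Integrable (fun u => (distinctSum (fun x => (φ x : ℂ)) u).re)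
    (z : Measure Configuration) := hi.re
  refine ⟨hre.1.aemeasurable.ennreal_ofReal, ?_⟩
  have hnn : ∀ u, 0 ≤ (distinctSum (fun x => (φ x : ℂ)) u).re := by
    intro u
    unfold distinctSum
    rw [← Complex.ofReal_tsum, Complex.ofReal_re]
    exact tsum_nonneg fun _ => h0 _
  rw [← ofReal_integral_eq_lintegral_ofReal hre (ae_of_all _ hnn)]
  refine ENNReal.ofReal_le_ofReal ?_
  have h1 : ∫ u, (distinctSum (fun x => (φ x : ℂ)) u).re ∂(z : Measure Configuration) =
      (∫ u, distinctSum (fun x => (φ x : ℂ)) u ∂(z : Measure Configuration)).re :=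
    integral_re hi
  have h2 : ∀ x : EuclideanSpace ℝ (Fin n), ((φ x : ℂ) *
      (((Matrix.of fun i j : Fin n => S (x i - x j)).det : ℝ) : ℂ)) =
      ((φ x * sineDet x : ℝ) : ℂ) := by
    intro x; push_cast [sineDet]; rfl
  rw [h1, he]
  simp_rw [h2]
  rw [integral_complex_ofReal, Complex.ofReal_re, ← integral_const_mul]
  have hint : Integrable φ := hc.integrable_of_hasCompactSupport hφ
  refine integral_mono ?_ (hint.const_mul _) fun x => ?_
  · exact (hc.mul continuous_sineDet).integrable_of_hasCompactSupport hφ.mul_right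
  · rw [mul_comm]
    exact mul_le_mul_of_nonneg_right ((le_abs_self _).trans (abs_sineDet_le x)) (h0 x)

/-- A continuous cutoff function, equal to `1` on `‖x‖ ≤ R` and to `0` on `‖x‖ ≥ R + 1`. -/
def cutoff {E : Type*} [NormedAddCommGroup E] (R : ℝ) (x : E) : ℝ := max 0 (min 1 (R + 1 - ‖x‖))

section Cutoff

variable {E : Type*} [NormedAddCommGroup E]

lemma cutoff_nonneg (R : ℝ) (x : E) : 0 ≤ cutoff R x := le_max_left _ _

lemma cutoff_le_one (R : ℝ) (x : E) : cutoff R x ≤ 1 :=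
  max_le zero_le_one (min_le_left _ _)

lemma cutoff_eq_one {R : ℝ} {x : E} (h : ‖x‖ ≤ R) : cutoff R x = 1 := by
  unfold cutoff
  rw [min_eq_left (by linarith), max_eq_right zero_le_one]

lemma cutoff_eq_zero {R : ℝ} {x : E} (h : R + 1 ≤ ‖x‖) : cutoff R x = 0 := by
  unfold cutoff
  rw [max_eq_left ((min_le_right _ _).trans (by linarith))]

lemma cutoff_mono {R R' : ℝ} (h : R ≤ R') (x : E) : cutoff R x ≤ cutoff R' x := by
  unfold cutoff; gcongr

lemma continuous_cutoff (R : ℝ) : Continuous (cutoff R : E → ℝ) := by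
  unfold cutoff; fun_prop

lemma hasCompactSupport_cutoff [ProperSpace E] (R : ℝ) : HasCompactSupport (cutoff R : E → ℝ) := by
  refine HasCompactSupport.of_support_subset_isCompact (isCompact_closedBall 0 (R + 1)) ?_
  intro x hx
  rw [mem_closedBall_zero_iff]
  by_contra h
  exact hx (cutoff_eq_zero (not_le.1 h).le)

end Cutoff

lemma distinctLSum_eq_iSup {n : ℕ} (φ : EuclideanSpace ℝ (Fin n) → ℝ) (h0 : ∀ x, 0 ≤ φ x)
    (u : Configuration) :
    distinctLSum (fun x => ENNReal.ofReal (φ x)) u =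
      ⨆ R : ℕ, distinctLSum (fun x => ENNReal.ofReal (φ x * cutoff (R : ℝ) x)) u := by
  apply le_antisymm
  · unfold distinctLSum
    rw [ENNReal.tsum_eq_iSup_sum]
    refine iSup_le fun s => ?_
    obtain ⟨R, hR⟩ := exists_nat_ge (∑ j ∈ s, ‖positions j‖)
    refine le_trans ?_ (le_iSup _ R)
    refine le_trans (Finset.sum_le_sum fun j hj => ?_) (ENNReal.sum_le_tsum s)
    beta_reduce
    rw [cutoff_eq_one, mul_one]
    exact (Finset.single_le_sum (f := fun j => ‖positions j‖)
      (fun _ _ => norm_nonneg _) hj).trans hR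
  · refine iSup_le fun R => ENNReal.tsum_le_tsum fun j => ENNReal.ofReal_le_ofReal ?_
    exact mul_le_of_le_one_right (h0 _) (cutoff_le_one _ _)

lemma lintegral_distinctLSum_lt_top {z : PointProcess} (hz : IsSineProcess z) {n : ℕ} (hn : 1 ≤ n)
    {φ : EuclideanSpace ℝ (Fin n) → ℝ} (h0 : ∀ x, 0 ≤ φ x) (hc : Continuous φ)
    (hφ : Integrable φ) :
    AEMeasurable (distinctLSum fun x => ENNReal.ofReal (φ x)) (z : Measure Configuration) ∧
    ∫⁻ u, distinctLSum (fun x => ENNReal.ofReal (φ x)) u ∂(z : Measure Configuration) < ∞ := by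
  have key := fun R : ℕ => lintegral_distinctLSum hz hn (φ := fun x => φ x * cutoff (R : ℝ) x)
    (fun x => mul_nonneg (h0 x) (cutoff_nonneg _ _)) (hc.mul (continuous_cutoff _))
    (hasCompactSupport_cutoff _).mul_left
  rw [show (distinctLSum fun x => ENNReal.ofReal (φ x)) = fun u => ⨆ R : ℕ,
    distinctLSum (fun x => ENNReal.ofReal (φ x * cutoff (R : ℝ) x)) u from
    funext (distinctLSum_eq_iSup φ h0)]
  refine ⟨AEMeasurable.iSup fun R => (key R).1, ?_⟩
  rw [lintegral_iSup' (fun R => (key R).1)]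
  · refine (iSup_le fun R => (key R).2.trans (ENNReal.ofReal_le_ofReal
      (q := n.factorial * ∫ x, φ x) ?_)).trans_lt ENNReal.ofReal_lt_top
    refine mul_le_mul_of_nonneg_left (integral_mono ?_ hφ fun x => ?_) (Nat.cast_nonneg _)
    · exact (hc.mul (continuous_cutoff _)).integrable_of_hasCompactSupport
        (hasCompactSupport_cutoff _).mul_left
    · exact mul_le_of_le_one_right (h0 _) (cutoff_le_one _ _)
  · refine ae_of_all _ fun u R R' hR => ENNReal.tsum_le_tsum fun j => ENNReal.ofReal_le_ofReal ?_
    exact mul_le_mul_of_nonneg_left (cutoff_mono (Nat.cast_le.2 hR) _) (h0 _)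

/-- The correlation identity of the sine process, for continuous integrable test functions. -/
theorem IsSineProcess.integral_distinctSum {z : PointProcess} (hz : IsSineProcess z) {n : ℕ}
    (hn : 1 ≤ n) {η : EuclideanSpace ℝ (Fin n) → ℂ} (hc : Continuous η) (hη : Integrable η) :
    ∫ u, distinctSum η u ∂(z : Measure Configuration) = ∫ x, η x * (sineDet x : ℂ) := by
  -- The absolute sum `T` of `‖η‖` is integrable, by monotone convergence along cutoffs. It then
  -- dominates the sums for the truncations `ηR`, to which the defining identity applies, and both
  -- sides pass to the limit.
  obtain ⟨hm, hlt⟩ := lintegral_distinctLSum_lt_top hz hn (φ := fun x => ‖η x‖)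
    (fun x => norm_nonneg _) hc.norm hη.norm
  set T := distinctLSum fun x => ENNReal.ofReal ‖η x‖ with hT
  let ηR : ℕ → EuclideanSpace ℝ (Fin n) → ℂ := fun R x => η x * ((cutoff (R : ℝ) x : ℝ) : ℂ)
  have hηR_le : ∀ R x, ‖ηR R x‖ ≤ ‖η x‖ := by
    intro R x
    simp only [ηR, norm_mul, Complex.norm_real, Real.norm_eq_abs, abs_of_nonneg (cutoff_nonneg _ x)]
    exact mul_le_of_le_one_right (norm_nonneg _) (cutoff_le_one _ _)
  have hηR_lim : ∀ x, Tendsto (fun R => ηR R x) atTop (𝓝 (η x)) := by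
    intro x
    refine tendsto_const_nhds.congr' ?_
    filter_upwards [eventually_ge_atTop ⌈‖x‖⌉₊] with R hR
    simp [ηR, cutoff_eq_one ((Nat.le_ceil _).trans (Nat.cast_le.2 hR))]
  have hsum : ∀ u, T u < ∞ → Summable fun j : Fin n ↪ u.Index => ‖η (positions j)‖ := by
    intro u hu
    have h : Summable fun j : Fin n ↪ u.Index => ‖η (positions j)‖₊ := by
      refine ENNReal.tsum_coe_ne_top_iff_summable.1 ?_
      have h := hu.ne
      simp only [T, distinctLSum, ofReal_norm] at h
      exact h
    exact NNReal.summable_coe.2 h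
  have hz' := fun R => hz n hn (ηR R) (hc.mul (Complex.continuous_ofReal.comp (continuous_cutoff _)))
    (HasCompactSupport.mul_left ((hasCompactSupport_cutoff (R : ℝ)).comp_left (g := fun x : ℝ => (x : ℂ)) rfl))
  have hfin : ∀ᵐ u ∂(z : Measure Configuration), T u < ∞ := ae_lt_top' hm hlt.ne
  have h1 : Tendsto (fun R => ∫ u, distinctSum (ηR R) u ∂(z : Measure Configuration)) atTop
      (𝓝 (∫ u, distinctSum η u ∂(z : Measure Configuration))) := by
    refine tendsto_integral_of_dominated_convergence (fun u => (T u).toReal)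
      (fun R => (hz' R).1.1) (integrable_toReal_of_lintegral_ne_top hm hlt.ne) (fun R => ?_) ?_
    · filter_upwards [hfin] with u hu
      have := hsum u hu
      unfold distinctSum
      refine (norm_tsum_le_tsum_norm (this.of_nonneg_of_le (fun _ => norm_nonneg _)
        fun j => hηR_le R _)).trans ?_
      have e : (T u).toReal = ∑' j : Fin n ↪ u.Index, ‖η (positions j)‖ := by
        simp only [T, distinctLSum]
        rw [← ENNReal.ofReal_tsum_of_nonneg (fun _ => norm_nonneg _) this,
          ENNReal.toReal_ofReal (tsum_nonneg fun _ => norm_nonneg _)]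
      rw [e]
      exact (this.of_nonneg_of_le (fun _ => norm_nonneg _) fun j => hηR_le R _).tsum_le_tsum
        (fun j => hηR_le R _) this
    · filter_upwards [hfin] with u hu
      exact tendsto_tsum_of_dominated_convergence (hsum u hu) (fun j => hηR_lim _)
        (Eventually.of_forall fun R j => hηR_le R _)
  have h2 : Tendsto (fun R => ∫ u, distinctSum (ηR R) u ∂(z : Measure Configuration)) atTop
      (𝓝 (∫ x, η x * (sineDet x : ℂ))) := by
    simp_rw [fun R => (hz' R).2]
    refine tendsto_integral_of_dominated_convergence (fun x => ‖η x‖ * n.factorial)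
      (fun R => ?_) (hη.norm.mul_const _) (fun R => ae_of_all _ fun x => ?_)
      (ae_of_all _ fun x => (hηR_lim x).mul_const _)
    · exact ((hc.mul (Complex.continuous_ofReal.comp (continuous_cutoff _))).mul
        (Complex.continuous_ofReal.comp continuous_sineDet)).aestronglyMeasurable
    · rw [norm_mul]
      refine mul_le_mul (hηR_le R x) ?_ (norm_nonneg _) (norm_nonneg _)
      rw [Complex.norm_real]
      exact abs_sineDet_le x
  exact tendsto_nhds_unique h1 h2

/-- Correlations control factorial moments. For `m > 2n` every factor of the falling factorial is at
least `m/2`; smaller `m` are absorbed in the constant. -/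
lemma pow_le_descFactorial (n m : ℕ) (hn : 1 ≤ n) :
    m ^ n ≤ (2 * n) ^ n + 2 ^ n * m.descFactorial n := by
  by_cases h : m ≤ 2 * n
  · exact (Nat.pow_le_pow_left h n).trans (Nat.le_add_right _ _)
  · have h1 := Nat.pow_sub_le_descFactorial m n
    calc m ^ n ≤ (2 * (m + 1 - n)) ^ n := Nat.pow_le_pow_left (by omega) n
      _ = 2 ^ n * (m + 1 - n) ^ n := mul_pow _ _ _
      _ ≤ 2 ^ n * m.descFactorial n := Nat.mul_le_mul_left _ h1
      _ ≤ _ := Nat.le_add_left _ _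

theorem IsSineProcess.uniformLocalMoments {z : PointProcess} (hz : IsSineProcess z) :
    UniformLocalMoments z := by
  intro n hn
  -- Recentred at `(L, …, L)`, this equals `1` on `[L, L+1]^n`, whose points are at distance at most
  -- `√n ≤ n`. Translation invariance of Lebesgue measure makes the bound independent of `L`.
  let φ : EuclideanSpace ℝ (Fin n) → ℝ := cutoff (n : ℝ)
  refine ⟨Real.toNNReal ((2 * n : ℝ) ^ n + 2 ^ n * (n.factorial * ∫ x, φ x)), fun L => ?_⟩
  let c : EuclideanSpace ℝ (Fin n) := WithLp.toLp 2 fun _ => L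
  obtain ⟨hm, hle⟩ := lintegral_distinctLSum hz hn (φ := fun x => φ (x - c))
    (fun x => cutoff_nonneg _ _) ((continuous_cutoff _).comp (by fun_prop))
    ((hasCompactSupport_cutoff _).comp_homeomorph (Homeomorph.subRight c))
  rw [integral_sub_right_eq_self φ c] at hle
  have hI : 0 ≤ ∫ x, φ x := integral_nonneg fun x => cutoff_nonneg _ _
  have key : ∀ u : Configuration, (u.count (Set.Icc L (L + 1)) : ℝ≥0∞) ^ n ≤
      ((2 * n : ℝ≥0∞)) ^ n + 2 ^ n * distinctLSum (fun x => ENNReal.ofReal (φ (x - c))) u := by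
    intro u
    have hf := finite_index_mem u (isCompact_Icc (a := L) (b := L + 1))
    have hcount : (u.count (Set.Icc L (L + 1)) : ℝ≥0∞) =
        (({j : u.Index | j.1 ∈ Set.Icc L (L + 1)}.ncard : ℕ) : ℝ≥0∞) := by
      unfold Configuration.count
      rw [← hf.cast_ncard_eq]; rfl
    rw [hcount]
    set V := {j : u.Index | j.1 ∈ Set.Icc L (L + 1)} with hV
    have hdesc : ((V.ncard.descFactorial n : ℕ) : ℝ≥0∞) ≤
        distinctLSum (fun x => ENNReal.ofReal (φ (x - c))) u := by
      have := hf.fintype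
      have hcard : V.ncard.descFactorial n = Fintype.card (Fin n ↪ V) := by
        rw [Fintype.card_embedding_eq, Fintype.card_fin, ← Nat.card_coe_set_eq, Nat.card_eq_fintype_card]
      let g : (Fin n ↪ V) → (Fin n ↪ u.Index) := fun j => j.trans (Function.Embedding.subtype _)
      have hg : Function.Injective g := by
        intro j j' h
        ext i : 2
        exact DFunLike.congr_fun h i
      have h1 : ∑' j : Fin n ↪ V, ENNReal.ofReal (φ (positions (g j) - c)) ≤
          distinctLSum (fun x => ENNReal.ofReal (φ (x - c))) u :=
        ENNReal.tsum_comp_le_tsum_of_injective hg fun j => ENNReal.ofReal (φ (positions j - c))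
      refine le_trans ?_ h1
      rw [hcard, tsum_fintype]
      have : ∀ j : Fin n ↪ V, ENNReal.ofReal (φ (positions (g j) - c)) = 1 := by
        intro j
        rw [show φ (positions (g j) - c) = 1 from cutoff_eq_one ?_, ENNReal.ofReal_one]
        rw [EuclideanSpace.norm_eq]
        refine Real.sqrt_le_iff.2 ⟨by positivity, ?_⟩
        have : ∀ i, ‖(positions (g j) - c) i‖ ^ 2 ≤ 1 := by
          intro i
          have hi : (j i).1.1 ∈ Set.Icc L (L + 1) := (j i).2
          have : (positions (g j) - c) i = (j i).1.1 - L := rfl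
          rw [this, Real.norm_eq_abs, sq_abs]
          nlinarith [hi.1, hi.2]
        refine (Finset.sum_le_sum fun i _ => this i).trans ?_
        have hn' : (1 : ℝ) ≤ n := by exact_mod_cast hn
        simp only [Finset.sum_const, Finset.card_univ, Fintype.card_fin, nsmul_eq_mul, mul_one]
        nlinarith
      simp [this]
    have h2 := pow_le_descFactorial n V.ncard hn
    have h3 : ((V.ncard : ℕ) : ℝ≥0∞) ^ n ≤
        (2 * n : ℝ≥0∞) ^ n + 2 ^ n * ((V.ncard.descFactorial n : ℕ) : ℝ≥0∞) := by
      exact_mod_cast h2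
    exact h3.trans (by gcongr)
  refine (lintegral_mono key).trans ?_
  rw [lintegral_add_left measurable_const, lintegral_const_mul'' _ hm, lintegral_const,
    measure_univ, mul_one]
  change _ ≤ ENNReal.ofReal _
  rw [ENNReal.ofReal_add (by positivity) (by positivity), ENNReal.ofReal_mul (by positivity),
    ENNReal.ofReal_pow (by positivity), ENNReal.ofReal_pow (by positivity),
    ENNReal.ofReal_mul zero_le_two, ENNReal.ofReal_natCast, ENNReal.ofReal_ofNat]
  gcongr

end SineProcess

/-! ### Poisson summation at the Nyquist rate -/

section Poisson

open Filter Topology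

/-- Every finite set of tuples sits in a box, over which the sum factors. -/
lemma summable_prod_pi {n : ℕ} {κ : Type*} {f : κ → ℝ} (hf : Summable f) (h0 : ∀ k, 0 ≤ f k) :
    Summable fun k : Fin n → κ => ∏ i, f (k i) := by
  classical
  refine summable_of_sum_le (c := (∑' k, f k) ^ n) (fun k => Finset.prod_nonneg fun i _ => h0 _)
    fun s => ?_
  let t : Finset κ := Finset.univ.biUnion fun i => s.image fun k => k i
  have hst : s ⊆ Fintype.piFinset fun _ : Fin n => t := by
    intro k hk
    simp only [Fintype.mem_piFinset, t, Finset.mem_biUnion, Finset.mem_image]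
    exact fun i => ⟨i, Finset.mem_univ _, k, hk, rfl⟩
  calc ∑ k ∈ s, ∏ i, f (k i) ≤ ∑ k ∈ Fintype.piFinset fun _ : Fin n => t, ∏ i, f (k i) :=
        Finset.sum_le_sum_of_subset_of_nonneg hst fun _ _ _ => Finset.prod_nonneg fun i _ => h0 _
    _ = ∏ _i : Fin n, ∑ k ∈ t, f k := (Finset.prod_univ_sum (fun _ => t) fun _ k => f k).symm
    _ = (∑ k ∈ t, f k) ^ n := by simp
    _ ≤ _ := pow_le_pow_left₀ (Finset.sum_nonneg fun k _ => h0 k)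
        (hf.sum_le_tsum t fun k _ => h0 k) n

lemma summable_inv_one_add_sq {a : ℝ} (ha : 0 < a) :
    Summable fun k : ℤ => (1 + (a * k) ^ 2)⁻¹ := by
  have h : Summable fun k : ℤ => (a ^ 2)⁻¹ * (1 / (k : ℝ) ^ 2) :=
    (Real.summable_one_div_int_pow.2 one_lt_two).mul_left _
  refine Summable.of_norm_bounded_eventually h ?_
  have : ∀ᶠ k : ℤ in cofinite, k ≠ 0 := (Set.finite_singleton (0 : ℤ)).compl_mem_cofinite
  filter_upwards [this] with k hk
  have hk' : (0 : ℝ) < (k : ℝ) ^ 2 := by positivity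
  rw [Real.norm_of_nonneg (by positivity), one_div, ← mul_inv, ← mul_pow]
  exact inv_anti₀ (by positivity) (by linarith)

/-- The point of the lattice `(aℤ)^n` with integer coordinates `k`. -/
abbrev latticePt {n : ℕ} (a : ℝ) (k : Fin n → ℤ) : EuclideanSpace ℝ (Fin n) :=
  WithLp.toLp 2 fun i => a * k i

lemma exists_schwartz_bound {n : ℕ} (η : SchwartzMap (EuclideanSpace ℝ (Fin n)) ℂ) :
    ∃ C : ℝ, ∀ x, ‖η x‖ ≤ C * ∏ i, (1 + (x i) ^ 2)⁻¹ := by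
  refine ⟨2 ^ (2 * n) * ((Finset.Iic (2 * n, 0)).sup fun m => SchwartzMap.seminorm ℝ m.1 m.2) η,
    fun x => ?_⟩
  have h := SchwartzMap.one_add_le_sup_seminorm_apply (𝕜 := ℝ) (m := (2 * n, 0)) (k := 2 * n)
    (n := 0) le_rfl le_rfl η x
  rw [norm_iteratedFDeriv_zero] at h
  have hpos : 0 < ∏ i, (1 + (x i) ^ 2) := Finset.prod_pos fun i _ => by positivity
  rw [Finset.prod_inv_distrib, ← div_eq_mul_inv, le_div_iff₀ hpos, mul_comm]
  refine le_trans (mul_le_mul_of_nonneg_right ?_ (norm_nonneg _)) h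
  rw [pow_mul]
  calc ∏ i, (1 + (x i) ^ 2) ≤ ∏ _i : Fin n, (1 + ‖x‖) ^ 2 := by
        refine Finset.prod_le_prod (fun i _ => by positivity) fun i _ => ?_
        have := PiLp.norm_apply_le x i
        rw [Real.norm_eq_abs] at this
        rw [← sq_abs]
        nlinarith [abs_nonneg (x i), norm_nonneg x]
    _ = ((1 + ‖x‖) ^ 2) ^ n := by simp

lemma summable_norm_lattice {n : ℕ} {a : ℝ} (ha : 0 < a)
    (η : SchwartzMap (EuclideanSpace ℝ (Fin n)) ℂ) :
    Summable fun k : Fin n → ℤ => ‖η (latticePt a k)‖ := by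
  obtain ⟨C, hC⟩ := exists_schwartz_bound η
  have h : Summable fun k : Fin n → ℤ => C * ∏ i, (1 + (a * k i) ^ 2)⁻¹ :=
    (summable_prod_pi (summable_inv_one_add_sq ha) fun k => by positivity).mul_left C
  exact Summable.of_nonneg_of_le (fun _ => norm_nonneg _) (fun k => hC (latticePt a k)) h

lemma isOpenQuotientMap_torus (n : ℕ) :
    IsOpenQuotientMap fun (y : Fin n → ℝ) (i : Fin n) => (y i : UnitAddCircle) :=
  IsOpenQuotientMap.piMap fun _ => QuotientAddGroup.isOpenQuotientMap_mk

/-- A continuous function which vanishes outside an open unit cube induces a continuous function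
on the torus. -/
lemma exists_torus_lift {n : ℕ} {g : (Fin n → ℝ) → ℂ} (hg : Continuous g)
    (h0 : ∀ y, (∃ i, 1 / 2 ≤ |y i|) → g y = 0) :
    ∃ H : C(UnitAddTorus (Fin n), ℂ), ∀ y : Fin n → ℝ, (∀ i, y i ∈ Set.Ioc (-(1 / 2)) (1 / 2)) →
      H (fun i => (y i : UnitAddCircle)) = g y := by
  -- The periodization of `g` over `ℤ^n` is locally a finite sum, hence continuous. On the half-open
  -- unit cube only the term `m = 0` survives, because any other shift moves some coordinate to
  -- modulus at least `1/2`.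
  let P : (Fin n → ℝ) → ℂ := fun y => ∑ᶠ m : Fin n → ℤ, g fun i => y i + m i
  have hP : Continuous P := by
    refine continuous_finsum (fun m => hg.comp (by fun_prop)) fun y₀ => ?_
    refine ⟨Set.univ.pi fun i => Set.Ioo (y₀ i - 1) (y₀ i + 1),
      set_pi_mem_nhds Set.finite_univ fun i _ => Ioo_mem_nhds (by linarith) (by linarith), ?_⟩
    refine (Set.Finite.pi (t := fun i => Set.Icc (-⌈y₀ i + 2⌉) ⌈2 - y₀ i⌉)
      fun i => Set.finite_Icc _ _).subset ?_
    rintro m ⟨y, hy1, hy2⟩ i -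
    have h1 : |y i + m i| < 1 / 2 := by
      by_contra hcon
      exact hy1 (h0 _ ⟨i, not_lt.1 hcon⟩)
    have h2 := hy2 i (Set.mem_univ _)
    rw [abs_lt] at h1
    constructor
    · have : -(m i : ℝ) ≤ ⌈y₀ i + 2⌉ := by linarith [Int.le_ceil (y₀ i + 2), h1.1, h2.2]
      have : -(m i) ≤ ⌈y₀ i + 2⌉ := by exact_mod_cast this
      linarith
    · have : (m i : ℝ) ≤ ⌈2 - y₀ i⌉ := by linarith [Int.le_ceil (2 - y₀ i), h1.2, h2.1]
      exact_mod_cast this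
  have hper : ∀ (y : Fin n → ℝ) (m : Fin n → ℤ), P (fun i => y i + m i) = P y := by
    intro y m
    refine finsum_eq_of_bijective (fun k => m + k) (Equiv.addLeft m).bijective fun k => ?_
    congr 1; ext i; simp [add_assoc]
  have : Fact ((0 : ℝ) < 1) := ⟨one_pos⟩
  let rep : UnitAddTorus (Fin n) → (Fin n → ℝ) := fun x i => (AddCircle.equivIoc 1 0 (x i)).1
  have hrep : ∀ y : Fin n → ℝ, P (rep fun i => (y i : UnitAddCircle)) = P y := by
    intro y
    have : ∀ i, ∃ m : ℤ, rep (fun i => (y i : UnitAddCircle)) i = y i + m := by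
      intro i
      have h : ((rep (fun i => (y i : UnitAddCircle)) i : ℝ) : UnitAddCircle) = y i :=
        (AddCircle.equivIoc 1 0).symm_apply_apply (y i : UnitAddCircle)
      rw [← sub_eq_zero, ← AddCircle.coe_sub, AddCircle.coe_eq_zero_iff] at h
      obtain ⟨m, hm⟩ := h
      refine ⟨m, ?_⟩
      rw [zsmul_one] at hm
      linarith
    choose m hm using this
    rw [← hper y m]
    congr 1
    exact funext hm
  refine ⟨⟨fun x => P (rep x), ?_⟩, fun y hy => ?_⟩
  · rw [(isOpenQuotientMap_torus n).isQuotientMap.continuous_iff]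
    exact hP.congr fun y => (hrep y).symm
  · change P (rep _) = _
    rw [hrep]
    change ∑ᶠ m : Fin n → ℤ, g (fun i => y i + m i) = g y
    rw [finsum_eq_single _ 0]
    · simp
    · intro m hm
      obtain ⟨i, hi⟩ := Function.ne_iff.1 hm
      refine h0 _ ⟨i, ?_⟩
      have := hy i
      rcases lt_or_gt_of_ne hi with h | h
      · have h' : (m i : ℝ) ≤ -1 := by exact_mod_cast Int.le_sub_one_of_lt h
        rw [le_abs]; right; linarith [this.2]
      · have h' : (1 : ℝ) ≤ m i := by exact_mod_cast h
        rw [le_abs]; left; linarith [this.1]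

/-- A Schwartz function whose Fourier transform is supported in a closed cube has a Fourier
transform that vanishes on the boundary of the cube. -/
lemma fourier_eq_zero_of_support {n : ℕ} {B : ℝ} (hB : 0 < B)
    {η : SchwartzMap (EuclideanSpace ℝ (Fin n)) ℂ}
    (hη : Function.support (𝓕 (η : EuclideanSpace ℝ (Fin n) → ℂ)) ⊆ {ξ | ∀ i, ξ i ∈ Set.Icc (-B) B})
    {ξ : EuclideanSpace ℝ (Fin n)} (hξ : ∃ i, B ≤ |ξ i|) :
    𝓕 (η : EuclideanSpace ℝ (Fin n) → ℂ) ξ = 0 := by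
  obtain ⟨i, hi⟩ := hξ
  have hc : Continuous (𝓕 (η : EuclideanSpace ℝ (Fin n) → ℂ)) := (𝓕 η).continuous
  -- Dilating by `t > 1` moves `ξ` strictly outside the cube, so a boundary value is a limit of
  -- zeros.
  have ht : Tendsto (fun t : ℝ => 𝓕 (η : EuclideanSpace ℝ (Fin n) → ℂ) (t • ξ)) (𝓝[>] 1)
      (𝓝 (𝓕 (η : EuclideanSpace ℝ (Fin n) → ℂ) ξ)) := by
    have : Continuous fun t : ℝ => 𝓕 (η : EuclideanSpace ℝ (Fin n) → ℂ) (t • ξ) :=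
      hc.comp (by fun_prop)
    simpa using (this.tendsto 1).mono_left (nhdsWithin_le_nhds (s := Set.Ioi 1))
  refine tendsto_nhds_unique ht (tendsto_const_nhds.congr' ?_)
  filter_upwards [self_mem_nhdsWithin] with t ht
  by_contra hcon
  have h1 := hη (Ne.symm hcon) i
  have h2 : |t * ξ i| ≤ B := abs_le.2 h1
  rw [abs_mul, abs_of_pos (zero_lt_one.trans ht)] at h2
  have : (1 : ℝ) < t := ht
  nlinarith

/-- The rescaled transform `y ↦ 𝓕 η (y/a)` lives on one unit cube and vanishes on its boundary, so
it descends to a continuous function on the torus without overlap. Its Fourier coefficients are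
samples of `η` by Fourier inversion, they are summable, and so its Fourier series converges to it
pointwise. -/
theorem hasSum_lattice_fourier {n : ℕ} {a : ℝ} (ha : 0 < a)
    {η : SchwartzMap (EuclideanSpace ℝ (Fin n)) ℂ}
    (hη : Function.support (𝓕 (η : EuclideanSpace ℝ (Fin n) → ℂ)) ⊆
      {ξ | ∀ i, ξ i ∈ Set.Icc (-(1 / (2 * a))) (1 / (2 * a))})
    {θ : EuclideanSpace ℝ (Fin n)} (hθ : ∀ i, |θ i| < 1 / (2 * a)) :
    HasSum (fun k : Fin n → ℤ => (a : ℂ) ^ n * η (latticePt a k) *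
      Complex.exp (-(2 * Real.pi * (∑ i, a * k i * θ i : ℝ) * Complex.I)))
      (𝓕 (η : EuclideanSpace ℝ (Fin n) → ℂ) θ) := by
  set h : EuclideanSpace ℝ (Fin n) → ℂ := 𝓕 (η : EuclideanSpace ℝ (Fin n) → ℂ) with hh
  have hc : Continuous h := (𝓕 η).continuous
  let g : (Fin n → ℝ) → ℂ := fun y => h (WithLp.toLp 2 (a⁻¹ • y))
  have hg : Continuous g := hc.comp (by fun_prop)
  have hg0 : ∀ y, (∃ i, 1 / 2 ≤ |y i|) → g y = 0 := by
    rintro y ⟨i, hi⟩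
    refine fourier_eq_zero_of_support (B := 1 / (2 * a)) (by positivity) hη ⟨i, ?_⟩
    simp only [Pi.smul_apply, smul_eq_mul, abs_mul, abs_inv, abs_of_pos ha]
    rw [one_div, mul_inv, mul_comm]
    gcongr
    linarith
  obtain ⟨H, hH⟩ := exists_torus_lift hg hg0
  have hcoeff : ∀ k : Fin n → ℤ, UnitAddTorus.mFourierCoeff H k =
      (a : ℂ) ^ n * η (latticePt a (-k)) := by
    intro k
    let F : EuclideanSpace ℝ (Fin n) → ℂ := fun ξ =>
      Complex.exp (((2 * Real.pi * inner ℝ ξ (latticePt a (-k)) : ℝ) : ℂ) * Complex.I) • h ξ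
    have hset : ∀ y : Fin n → ℝ, y ∉ {x : Fin n → ℝ | ∀ i, x i ∈ Set.Ioc ((fun _ => -(1 / 2 : ℝ)) i) ((fun _ => -(1 / 2 : ℝ)) i + 1)} →
        F (WithLp.toLp 2 (a⁻¹ • y)) = 0 := by
      intro y hy
      have : g y = 0 := by
        refine hg0 y ?_
        by_contra hcon
        push Not at hcon
        refine hy fun i => ?_
        have := abs_lt.1 (hcon i)
        exact ⟨this.1, by linarith [this.2]⟩
      change _ • g y = 0
      rw [this, smul_zero]
    rw [UnitAddTorus.mFourierCoeff_eq_integral (H : UnitAddTorus (Fin n) → ℂ) k (fun _ => -(1 / 2))]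
    have hm : MeasurableSet {x : Fin n → ℝ | ∀ i, x i ∈ Set.Ioc ((fun _ => -(1 / 2 : ℝ)) i) ((fun _ => -(1 / 2 : ℝ)) i + 1)} :=
      MeasurableSet.univ_pi' fun i => measurableSet_Ioc
    rw [setIntegral_congr_fun hm (g := fun y => F (WithLp.toLp 2 (a⁻¹ • y))),
      setIntegral_eq_integral_of_forall_compl_eq_zero hset]
    · rw [Measure.integral_comp_smul volume (fun y : Fin n → ℝ => F (WithLp.toLp 2 y)) a⁻¹,
        (PiLp.volume_preserving_toLp (Fin n)).integral_comp
          (MeasurableEquiv.toLp 2 (Fin n → ℝ)).measurableEmbedding]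
      have h1 : ∫ ξ, F ξ = η (latticePt a (-k)) := by
        have e1 := Real.fourierInv_eq' h (latticePt a (-k))
        rw [← show 𝓕⁻ h (latticePt a (-k)) = ∫ ξ, F ξ from e1]
        have : 𝓕⁻ (𝓕 η) = η := FourierTransform.fourierInv_fourier_eq η
        conv_rhs => rw [← this]
        rw [SchwartzMap.fourierInv_coe, SchwartzMap.fourier_coe]
      rw [h1, Module.finrank_fin_fun, inv_pow, inv_inv, abs_of_pos (by positivity)]
      simp
    · intro y hy
      have hy' : ∀ i, y i ∈ Set.Ioc (-(1 / 2 : ℝ)) (1 / 2) := fun i => ⟨(hy i).1, by linarith [(hy i).2]⟩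
      change UnitAddTorus.mFourier (-k) (fun i => (y i : UnitAddCircle)) • H _ = _
      rw [hH y hy']
      change _ = _ • g y
      congr 1
      simp only [UnitAddTorus.mFourier, ContinuousMap.coe_mk, fourier_coe_apply]
      rw [← Complex.exp_sum]
      congr 1
      simp only [PiLp.inner_apply, latticePt]
      simp only [Pi.smul_apply, Pi.neg_apply, smul_eq_mul, RCLike.inner_apply, conj_trivial]
      push_cast
      rw [Finset.mul_sum, Finset.sum_mul]
      refine Finset.sum_congr rfl fun i _ => ?_
      have : (a : ℂ) ≠ 0 := by exact_mod_cast ha.ne'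
      field_simp
  have hsum : Summable (UnitAddTorus.mFourierCoeff (H : UnitAddTorus (Fin n) → ℂ)) := by
    simp_rw [funext hcoeff]
    refine Summable.mul_left _ (.of_norm ?_)
    exact (Equiv.neg (Fin n → ℤ)).summable_iff.2 (summable_norm_lattice ha η)
  have key := UnitAddTorus.hasSum_mFourier_series_apply_of_summable hsum
    (fun i => ((a * θ i : ℝ) : UnitAddCircle))
  have hθ' : ∀ i, |a * θ i| < 1 / 2 := by
    intro i
    rw [abs_mul, abs_of_pos ha]
    have := mul_lt_mul_of_pos_left (hθ i) ha
    rwa [show a * (1 / (2 * a)) = 1 / 2 by field_simp] at this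
  rw [hH (fun i => a * θ i) fun i => ⟨(abs_lt.1 (hθ' i)).1, (abs_lt.1 (hθ' i)).2.le⟩] at key
  have hval : g (fun i => a * θ i) = h θ := by
    simp only [g]
    congr 1
    ext i
    simp [ha.ne']
  rw [hval] at key
  -- The `k`-th torus coefficient is the sample at `-ak`; the reflection restores the sign.
  rw [← (Equiv.neg (Fin n → ℤ)).hasSum_iff] at key
  convert key using 2 with k
  simp only [Function.comp_apply, Equiv.neg_apply, hcoeff, neg_neg, smul_eq_mul,
    UnitAddTorus.mFourier, ContinuousMap.coe_mk, fourier_coe_apply]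
  rw [← Complex.exp_sum]
  congr 2
  push_cast
  rw [Finset.mul_sum, Finset.sum_mul, ← Finset.sum_neg_distrib]
  refine Finset.sum_congr rfl fun i _ => ?_
  simp
  ring

end Poisson

/-! ### Determinantal processes with kernel between 0 and 1 -/

section DeterminantalMeasure

open Matrix Filter Topology

variable {ι : Type*}

/-- The probability weight that a determinantal process with kernel `K` on a finite set gives to
the configuration whose set of holes is `s`. -/
def holeWeight [Fintype ι] [DecidableEq ι] (K : Matrix ι ι ℝ) (s : Finset ι) : ℝ :=
  (Matrix.of <| s.piecewise (1 - K : Matrix ι ι ℝ).row K.row).det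

/-- Multilinear expansion in the rows outside `C`: the rows of `1 - K` and `K` add up to rows of the
identity, leaving the principal minor on `C`. Probabilistically, summing over hole sets that avoid
`C` gives the probability that `C` is occupied. -/
lemma sum_holeWeight [Fintype ι] [DecidableEq ι] (K : Matrix ι ι ℝ) (C : Finset ι) :
    ∑ s ∈ Cᶜ.powerset, holeWeight K s =
      (K.submatrix (Subtype.val : C → ι) (Subtype.val : C → ι)).det := by
  have h := (detRowAlternating (R := ℝ) (n := ι)).toMultilinearMap.map_piecewise_add
    (1 - K : Matrix ι ι ℝ).row K.row Cᶜ
  rw [← Matrix.det_piecewise_one_eq_submatrix_det]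
  refine h.symm.trans ?_
  change (Matrix.of <| Cᶜ.piecewise ((1 - K : Matrix ι ι ℝ).row + K.row) K.row).det = _
  have h1 : (1 - K : Matrix ι ι ℝ).row + K.row = (1 : Matrix ι ι ℝ).row := by
    ext i j; change (1 - K + K) i j = _; rw [sub_add_cancel]; rfl
  rw [h1, Finset.piecewise_compl]

/-- The L-ensemble form, with `L = K(1 - K)⁻¹` when the inverse exists: factoring `1 - K` out on the
right turns hole rows into identity rows and the others into rows of `L`. -/
lemma holeWeight_eq_mul [Fintype ι] [DecidableEq ι] {K L : Matrix ι ι ℝ}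
    (hL : L * (1 - K) = K) (s : Finset ι) :
    holeWeight K s = (L.submatrix (Subtype.val : ↥sᶜ → ι) (Subtype.val : ↥sᶜ → ι)).det *
      (1 - K).det := by
  rw [← Matrix.det_piecewise_one_eq_submatrix_det, ← Matrix.det_mul]
  unfold holeWeight
  congr 1
  ext i j
  by_cases hi : i ∈ s
  · simp [Finset.piecewise, hi, Matrix.mul_apply, Matrix.one_apply]
  · have : (L * (1 - K)) i j = K i j := by rw [hL]
    simpa [Finset.piecewise, hi, Matrix.mul_apply] using this.symm

lemma holeWeight_nonneg_of_posDef [Fintype ι] [DecidableEq ι] {K : Matrix ι ι ℝ}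
    (hK : K.PosSemidef) (hK' : (1 - K).PosDef) (s : Finset ι) : 0 ≤ holeWeight K s := by
  -- With `R = (1 - K)⁻¹`, the L-ensemble matrix is `R - 1 = K + K R K`, visibly positive
  -- semidefinite.
  have hu : IsUnit (1 - K).det := hK'.det_pos.ne'.isUnit
  have h1 : (1 - K)⁻¹ * (1 - K) = 1 := Matrix.nonsing_inv_mul _ hu
  have h2 : (1 - K) * (1 - K)⁻¹ = 1 := Matrix.mul_nonsing_inv _ hu
  have hR : ((1 - K)⁻¹).PosSemidef := hK'.inv.posSemidef
  set R := (1 - K)⁻¹ with hRdef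
  have h3 : R = 1 + K + K * R * K := by
    have e1 : R = 1 + R * K := by
      have := h1; rw [mul_sub, mul_one, sub_eq_iff_eq_add] at this; exact this
    have e2 : R = 1 + K * R := by
      have := h2; rw [sub_mul, one_mul, sub_eq_iff_eq_add] at this; exact this
    calc R = 1 + K * R := e2
      _ = 1 + K * (1 + R * K) := by rw [← e1]
      _ = _ := by rw [mul_add, mul_one, ← add_assoc, mul_assoc]
  have hL : (R - 1) * (1 - K) = K := by rw [sub_mul, h1, one_mul, sub_sub_cancel]
  have hLp : (R - 1).PosSemidef := by
    have : R - 1 = K + K * R * K := by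
      nth_rewrite 1 [h3]; abel
    rw [this]
    refine hK.add ?_
    have := hR.conjTranspose_mul_mul_same K
    rwa [hK.isHermitian.eq] at this
  rw [holeWeight_eq_mul hL]
  exact mul_nonneg (hLp.submatrix _).det_nonneg hK'.det_pos.le

lemma holeWeight_nonneg [Fintype ι] [DecidableEq ι] {K : Matrix ι ι ℝ}
    (hK : K.PosSemidef) (hK' : (1 - K).PosSemidef) (s : Finset ι) : 0 ≤ holeWeight K s := by
  have hc : Continuous fun t : ℝ => holeWeight (t • K) s := by
    unfold holeWeight
    refine Continuous.matrix_det ?_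
    refine continuous_pi fun i => continuous_pi fun j => ?_
    by_cases hi : i ∈ s <;> simp [Finset.piecewise, hi] <;> fun_prop
  have ht : Tendsto (fun t : ℝ => holeWeight (t • K) s) (𝓝[<] 1) (𝓝 (holeWeight K s)) := by
    have := (hc.tendsto 1).mono_left (nhdsWithin_le_nhds (s := Set.Iio 1))
    simpa using this
  refine ge_of_tendsto ht ?_
  filter_upwards [Ioo_mem_nhdsLT (zero_lt_one (α := ℝ))] with t ht
  refine holeWeight_nonneg_of_posDef (hK.smul ht.1.le) ?_ s
  -- Shrinking `K` to `tK` with `t < 1` makes `1 - tK` strictly positive; the weight is continuous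
  -- as `t ↑ 1`.
  have : 1 - t • K = t • (1 - K) + (1 - t) • (1 : Matrix ι ι ℝ) := by
    rw [smul_sub, sub_smul, one_smul]; abel
  rw [this]
  exact Matrix.PosDef.posSemidef_add (hK'.smul ht.1.le)
    (Matrix.PosDef.one.smul (by linarith [ht.2]))

/-- The event that all sites of `C` are occupied. -/
def occupied (C : Finset ι) : Set (ι → Bool) := {ω | ∀ i ∈ C, ω i = true}

lemma isClopen_occupied (C : Finset ι) : IsClopen (occupied C) := by
  have : occupied C = ⋂ i ∈ C, (fun ω : ι → Bool => ω i) ⁻¹' {true} := by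
    ext ω; simp [occupied]
  rw [this]
  exact isClopen_biInter_finset fun i _ => (isClopen_discrete _).preimage (continuous_apply i)

lemma measurableSet_occupied (C : Finset ι) : MeasurableSet (occupied C) := by
  have : occupied C = ⋂ i ∈ C, (fun ω : ι → Bool => ω i) ⁻¹' {true} := by
    ext ω; simp [occupied]
  rw [this]
  exact Finset.measurableSet_biInter _ fun i _ => (measurable_pi_apply i) (measurableSet_singleton _)

lemma exists_finite_determinantal [DecidableEq ι] (K : Matrix ι ι ℝ) (Λ : Finset ι)
    (hK : (K.submatrix (Subtype.val : Λ → ι) (Subtype.val : Λ → ι)).PosSemidef)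
    (hK' : (1 - K.submatrix (Subtype.val : Λ → ι) (Subtype.val : Λ → ι)).PosSemidef) :
    ∃ μ : ProbabilityMeasure (ι → Bool), ∀ C ⊆ Λ, (μ : Measure (ι → Bool)) (occupied C) =
      ENNReal.ofReal (K.submatrix (Subtype.val : C → ι) (Subtype.val : C → ι)).det := by
  set KΛ := K.submatrix (Subtype.val : Λ → ι) (Subtype.val : Λ → ι) with hKΛ
  let ω : Finset Λ → ι → Bool := fun s i => decide (∃ h : i ∈ Λ, (⟨i, h⟩ : Λ) ∉ s)
  let μ : Measure (ι → Bool) :=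
    ∑ s : Finset Λ, ENNReal.ofReal (holeWeight KΛ s) • Measure.dirac (ω s)
  have key : ∀ C ⊆ Λ, μ (occupied C) =
      ENNReal.ofReal (K.submatrix (Subtype.val : C → ι) (Subtype.val : C → ι)).det := by
    intro C hC
    let C' : Finset Λ := C.subtype (· ∈ Λ)
    have hdet : (K.submatrix (Subtype.val : C → ι) (Subtype.val : C → ι)).det =
        (KΛ.submatrix (Subtype.val : C' → Λ) (Subtype.val : C' → Λ)).det := by
      let e : C' ≃ C :=
        { toFun := fun x => ⟨x.1.1, Finset.mem_subtype.1 x.2⟩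
          invFun := fun x => ⟨⟨x.1, hC x.2⟩, by simp [C', x.2]⟩
          left_inv := fun _ => rfl
          right_inv := fun _ => rfl }
      rw [← Matrix.det_submatrix_equiv_self e]
      rfl
    have hmem : ∀ s : Finset Λ, ω s ∈ occupied C ↔ s ∈ C'ᶜ.powerset := by
      intro s
      simp only [occupied, ω, Set.mem_ofPred_eq, decide_eq_true_eq, Finset.mem_powerset, C']
      constructor
      · intro h x hx
        simp only [Finset.mem_compl, Finset.mem_subtype]
        intro hxC
        obtain ⟨_, h2⟩ := h x.1 hxC
        exact h2 hx
      · intro h i hi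
        refine ⟨hC hi, fun hs => ?_⟩
        have := h hs
        simp [hi] at this
    rw [hdet, ← sum_holeWeight, ENNReal.ofReal_sum_of_nonneg fun s _ => holeWeight_nonneg hK hK' s]
    simp only [μ, Measure.coe_finsetSum, Finset.sum_apply, Measure.smul_apply, smul_eq_mul]
    rw [← Finset.sum_filter_add_sum_filter_not Finset.univ (fun s => s ∈ C'ᶜ.powerset)]
    rw [Finset.sum_congr rfl (g := fun s => ENNReal.ofReal (holeWeight KΛ s)),
      Finset.sum_eq_zero (s := Finset.univ.filter fun s => ¬ s ∈ C'ᶜ.powerset), add_zero]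
    · congr 1; ext s; simp
    · intro s hs
      rw [Measure.dirac_apply' _ (measurableSet_occupied C)]
      have : ω s ∉ occupied C := by rw [hmem]; exact (Finset.mem_filter.1 hs).2
      simp [this]
    · intro s hs
      rw [Measure.dirac_apply' _ (measurableSet_occupied C)]
      have : ω s ∈ occupied C := by rw [hmem]; exact (Finset.mem_filter.1 hs).2
      simp [this]
  refine ⟨⟨μ, ⟨?_⟩⟩, key⟩
  -- Total mass `1` is the case `C = ∅`, where the determinant is that of an empty matrix.
  have := key ∅ (Finset.empty_subset _)
  have h : occupied (∅ : Finset ι) = Set.univ := by ext; simp [occupied]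
  rw [h] at this
  rw [this, Matrix.det_isEmpty, ENNReal.ofReal_one]

/-- Existence of the determinantal process with a given contractive kernel on a countable set. -/
theorem exists_determinantal [Countable ι] [DecidableEq ι] (K : Matrix ι ι ℝ)
    (hK : ∀ Λ : Finset ι, (K.submatrix (Subtype.val : Λ → ι) (Subtype.val : Λ → ι)).PosSemidef)
    (hK' : ∀ Λ : Finset ι,
      (1 - K.submatrix (Subtype.val : Λ → ι) (Subtype.val : Λ → ι)).PosSemidef) :
    ∃ μ : ProbabilityMeasure (ι → Bool), ∀ C : Finset ι, (μ : Measure (ι → Bool)) (occupied C) =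
      ENNReal.ofReal (K.submatrix (Subtype.val : C → ι) (Subtype.val : C → ι)).det := by
  choose μ hμ using fun Λ => exists_finite_determinantal K Λ (hK Λ) (hK' Λ)
  -- The probability measures on `{0,1}^ι` form a compact space, so the finite-volume laws have a
  -- limit along an ultrafilter. Occupation events are clopen, hence their probabilities pass to the
  -- limit, and each is eventually constant.
  let U : Ultrafilter (Finset ι) := Ultrafilter.of atTop
  have hU : (U : Filter (Finset ι)) ≤ atTop := Ultrafilter.of_le _
  obtain ⟨ν, -, hν⟩ := (isCompact_univ (X := ProbabilityMeasure (ι → Bool))).ultrafilter_le_nhds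
    (U.map μ) (by simp)
  have hν' : Tendsto μ U (𝓝 ν) := hν
  refine ⟨ν, fun C => ?_⟩
  have h1 := ProbabilityMeasure.tendsto_measure_of_null_frontier_of_tendsto' hν'
    (E := occupied C) (by rw [(isClopen_occupied C).frontier_eq]; simp)
  have h2 : Tendsto (fun Λ => (μ Λ : Measure (ι → Bool)) (occupied C)) U
      (𝓝 (ENNReal.ofReal (K.submatrix (Subtype.val : C → ι) (Subtype.val : C → ι)).det)) := by
    refine tendsto_const_nhds.congr' ?_
    filter_upwards [hU (eventually_ge_atTop C)] with Λ hΛ using (hμ Λ C hΛ).symm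
  exact tendsto_nhds_unique h1 h2

end DeterminantalMeasure

/-! ### Lattice sums against the sine determinant, and the lattice kernel -/

section SincKernel

open Filter Topology

lemma integral_exp_eq_sinc (b x : ℝ) (hb : 0 ≤ b) :
    ∫ t in Set.Ioo (-b) b, Complex.exp ((2 * Real.pi * x * t : ℝ) * Complex.I) =
      ((2 * b * Real.sinc (2 * Real.pi * b * x) : ℝ) : ℂ) := by
  rw [← integral_Ioc_eq_integral_Ioo, ← intervalIntegral.integral_of_le (by linarith)]
  rcases eq_or_ne x 0 with rfl | hx
  · simp [two_mul]
  · have h := intervalIntegral.integral_comp_mul_left (a := -b) (b := b)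
      (fun t : ℝ => Complex.exp ((t : ℝ) * Complex.I)) (c := 2 * Real.pi * x) (by positivity)
    rw [h, mul_neg, integral_exp_mul_I_eq_sinc]
    have h2 : (x : ℂ) ≠ 0 := by exact_mod_cast hx
    have h3 : (Real.pi : ℂ) ≠ 0 := by exact_mod_cast Real.pi_ne_zero
    rw [Complex.real_smul, show 2 * Real.pi * x * b = 2 * Real.pi * b * x by ring]
    push_cast
    field_simp

lemma integral_exp_eq_S (x : ℝ) :
    ∫ t in Set.Ioo (-(1 / 2) : ℝ) (1 / 2), Complex.exp ((2 * Real.pi * x * t : ℝ) * Complex.I) =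
      (S x : ℂ) := by
  rw [integral_exp_eq_sinc _ _ (by norm_num), S]
  congr 1
  rw [show 2 * Real.pi * (1 / 2) * x = Real.pi * x by ring]
  ring

/-- The uniform probability measure on the cube `(-1/2, 1/2)^n`. -/
def cubeMeasure (n : ℕ) : Measure (Fin n → ℝ) :=
  Measure.pi fun _ : Fin n => volume.restrict (Set.Ioo (-(1 / 2) : ℝ) (1 / 2))

instance (n : ℕ) : IsProbabilityMeasure (cubeMeasure n) := by
  have : IsProbabilityMeasure (volume.restrict (Set.Ioo (-(1 / 2) : ℝ) (1 / 2))) :=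
    ⟨by rw [Measure.restrict_apply_univ, Real.volume_Ioo]; norm_num⟩
  unfold cubeMeasure; infer_instance

lemma ae_cubeMeasure (n : ℕ) : ∀ᵐ t ∂cubeMeasure n, ∀ i, |t i| < 1 / 2 := by
  rw [ae_all_iff]
  intro i
  have h : ∀ᵐ s ∂(volume.restrict (Set.Ioo (-(1 / 2) : ℝ) (1 / 2))), |s| < 1 / 2 := by
    filter_upwards [ae_restrict_mem measurableSet_Ioo] with s hs using abs_lt.2 hs
  exact (Measure.quasiMeasurePreserving_eval (fun _ : Fin n =>
    volume.restrict (Set.Ioo (-(1 / 2) : ℝ) (1 / 2))) i).ae h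

/-- The frequency at which the permutation `σ` term of the sine determinant oscillates. -/
def permFreq {n : ℕ} (σ : Equiv.Perm (Fin n)) (t : Fin n → ℝ) : EuclideanSpace ℝ (Fin n) :=
  WithLp.toLp 2 fun i => t i - t (σ⁻¹ i)

/-- Each `S` is an average of plane waves over `(-1/2, 1/2)`. Collecting the exponent by `x_i` gives
the frequency `t_i - t_{σ⁻¹ i}`, up to sign. -/
lemma prod_S_eq_integral {n : ℕ} (σ : Equiv.Perm (Fin n)) (x : EuclideanSpace ℝ (Fin n)) :
    ((∏ i, S (x (σ i) - x i) : ℝ) : ℂ) = ∫ t, Complex.exp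
      (-(2 * Real.pi * (∑ i, x i * permFreq σ t i : ℝ) * Complex.I)) ∂cubeMeasure n := by
  rw [cubeMeasure]
  push_cast
  simp_rw [← integral_exp_eq_S]
  rw [← integral_fintype_prod_eq_prod]
  refine integral_congr_ae (ae_of_all _ fun t => ?_)
  simp only
  rw [← Complex.exp_sum]
  congr 1
  rw [← Finset.sum_mul, ← Complex.ofReal_sum]
  have : ∑ i, 2 * Real.pi * (x (σ i) - x i) * t i =
      -(2 * Real.pi * ∑ i, x i * permFreq σ t i) := by
    have h : ∑ i, x i * t (σ⁻¹ i) = ∑ i, x (σ i) * t i := by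
      rw [← Equiv.sum_comp σ]; simp
    simp only [permFreq, mul_sub, Finset.sum_sub_distrib, h, Finset.mul_sum, sub_mul, neg_sub,
      mul_assoc]
  rw [this]
  push_cast
  ring

lemma continuous_permFreq {n : ℕ} (σ : Equiv.Perm (Fin n)) : Continuous (permFreq σ) := by
  unfold permFreq; fun_prop

lemma hasSum_lattice_prod_S {n : ℕ} {a : ℝ} (ha : 0 < a) (ha' : a ≤ 1 / 2)
    {η : SchwartzMap (EuclideanSpace ℝ (Fin n)) ℂ}
    (hη : Function.support (𝓕 (η : EuclideanSpace ℝ (Fin n) → ℂ)) ⊆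
      {ξ | ∀ i, ξ i ∈ Set.Icc (-(1 / (2 * a))) (1 / (2 * a))}) (σ : Equiv.Perm (Fin n)) :
    HasSum (fun k : Fin n → ℤ => (a : ℂ) ^ n * η (latticePt a k) *
      ((∏ i, S (latticePt a k (σ i) - latticePt a k i) : ℝ) : ℂ))
      (∫ x, η x * ((∏ i, S (x (σ i) - x i) : ℝ) : ℂ)) := by
  let F : (Fin n → ℤ) → (Fin n → ℝ) → ℂ := fun k t => (a : ℂ) ^ n * η (latticePt a k) *
    Complex.exp (-(2 * Real.pi * (∑ i, a * k i * permFreq σ t i : ℝ) * Complex.I))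
  have hnorm : ∀ r : ℝ, ‖Complex.exp (-(2 * Real.pi * (r : ℝ) * Complex.I))‖ = 1 := by
    intro r
    have : -(2 * Real.pi * (r : ℝ) * Complex.I) = ((-(2 * Real.pi * r) : ℝ) : ℂ) * Complex.I := by
      push_cast; ring
    rw [this, Complex.norm_exp_ofReal_mul_I]
  have hFn : ∀ k t, ‖F k t‖ = a ^ n * ‖η (latticePt a k)‖ := by
    intro k t
    simp only [F, norm_mul, hnorm, mul_one, norm_pow, Complex.norm_real, Real.norm_of_nonneg ha.le]
  have hFc : ∀ k, Continuous (F k) := by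
    intro k
    have := continuous_permFreq σ
    fun_prop
  have h := hasSum_integral_of_summable_integral_norm (μ := cubeMeasure n) (F := F)
    (fun k => Integrable.of_bound (hFc k).aestronglyMeasurable (a ^ n * ‖η (latticePt a k)‖)
      (ae_of_all _ fun t => (hFn k t).le)) (by
        simp_rw [hFn, integral_const, probReal_univ, one_smul]
        exact (summable_norm_lattice ha η).mul_left _)
  have e1 : ∀ k, ∫ t, F k t ∂cubeMeasure n = (a : ℂ) ^ n * η (latticePt a k) *
      ((∏ i, S (latticePt a k (σ i) - latticePt a k i) : ℝ) : ℂ) := by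
    intro k
    rw [prod_S_eq_integral, ← integral_const_mul]
  have e2 : ∫ t, ∑' k, F k t ∂cubeMeasure n =
      ∫ x, η x * ((∏ i, S (x (σ i) - x i) : ℝ) : ℂ) := by
    have h1 : ∀ᵐ t ∂cubeMeasure n, ∑' k, F k t = ∫ v, η v *
        Complex.exp (-(2 * Real.pi * (∑ i, v i * permFreq σ t i : ℝ) * Complex.I)) := by
      filter_upwards [ae_cubeMeasure n] with t ht
      have hθ : ∀ i, |permFreq σ t i| < 1 / (2 * a) := by
        intro i
        -- The decisive use of `a ≤ 1/2`: differences of two frequencies below `1/2` in modulus stay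
        -- strictly inside the band.
        have h1 : (1 : ℝ) ≤ 1 / (2 * a) := by rw [le_div_iff₀ (by positivity)]; linarith
        have h2 := abs_sub (t i) (t (σ⁻¹ i))
        have : permFreq σ t i = t i - t (σ⁻¹ i) := rfl
        rw [this]
        linarith [ht i, ht (σ⁻¹ i)]
      rw [(hasSum_lattice_fourier ha hη hθ).tsum_eq, Real.fourier_eq']
      refine integral_congr_ae (ae_of_all _ fun v => ?_)
      simp only [smul_eq_mul, PiLp.inner_apply, RCLike.inner_apply, conj_trivial]
      rw [mul_comm]
      congr 2
      push_cast
      simp only [mul_comm]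
      ring
    rw [integral_congr_ae h1]
    simp_rw [prod_S_eq_integral, ← integral_const_mul]
    refine integral_integral_swap ?_
    have hi : Integrable (fun p : (Fin n → ℝ) × EuclideanSpace ℝ (Fin n) => η p.2)
      ((cubeMeasure n).prod volume) := η.integrable.comp_snd _
    refine hi.mono ?_ (ae_of_all _ fun p => ?_)
    · have h1 := continuous_permFreq σ
      have h2 := η.continuous
      have : Continuous fun p : (Fin n → ℝ) × EuclideanSpace ℝ (Fin n) => η p.2 *
          Complex.exp (-(2 * Real.pi * (∑ i, p.2 i * permFreq σ p.1 i : ℝ) * Complex.I)) := by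
        fun_prop
      exact this.aestronglyMeasurable
    · simp only [Function.uncurry, norm_mul, hnorm, mul_one, le_refl]
  simp_rw [e1, e2] at h
  exact h

theorem hasSum_lattice_sineDet {n : ℕ} {a : ℝ} (ha : 0 < a) (ha' : a ≤ 1 / 2)
    {η : SchwartzMap (EuclideanSpace ℝ (Fin n)) ℂ}
    (hη : Function.support (𝓕 (η : EuclideanSpace ℝ (Fin n) → ℂ)) ⊆
      {ξ | ∀ i, ξ i ∈ Set.Icc (-(1 / (2 * a))) (1 / (2 * a))}) :
    HasSum (fun k : Fin n → ℤ => η (latticePt a k) * ((a ^ n * sineDet (latticePt a k) : ℝ) : ℂ))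
      (∫ x, η x * (sineDet x : ℂ)) := by
  have hdet : ∀ x : EuclideanSpace ℝ (Fin n), (sineDet x : ℂ) =
      ∑ σ : Equiv.Perm (Fin n), ((Equiv.Perm.sign σ : ℤ) : ℂ) *
        ((∏ i, S (x (σ i) - x i) : ℝ) : ℂ) := by
    intro x
    rw [sineDet, Matrix.det_apply']
    push_cast
    rfl
  have h := hasSum_sum (s := Finset.univ) fun (σ : Equiv.Perm (Fin n)) _ =>
    (hasSum_lattice_prod_S ha ha' hη σ).mul_left ((Equiv.Perm.sign σ : ℤ) : ℂ)
  have e1 : ∀ k : Fin n → ℤ, η (latticePt a k) * ((a ^ n * sineDet (latticePt a k) : ℝ) : ℂ) =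
      ∑ σ : Equiv.Perm (Fin n), ((Equiv.Perm.sign σ : ℤ) : ℂ) * ((a : ℂ) ^ n * η (latticePt a k) *
      ((∏ i, S (latticePt a k (σ i) - latticePt a k i) : ℝ) : ℂ)) := by
    intro k
    rw [Complex.ofReal_mul, hdet, Finset.mul_sum, Finset.mul_sum]
    refine Finset.sum_congr rfl fun σ _ => ?_
    push_cast
    ring
  have e2 : ∫ x, η x * (sineDet x : ℂ) = ∑ σ : Equiv.Perm (Fin n),
      ((Equiv.Perm.sign σ : ℤ) : ℂ) * ∫ x, η x * ((∏ i, S (x (σ i) - x i) : ℝ) : ℂ) := by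
    simp_rw [hdet, Finset.mul_sum, ← integral_const_mul]
    rw [integral_finsetSum]
    · refine Finset.sum_congr rfl fun σ _ => integral_congr_ae (ae_of_all _ fun x => ?_)
      simp only
      ring
    · intro σ _
      have hc : Continuous fun x : EuclideanSpace ℝ (Fin n) =>
          ((Equiv.Perm.sign σ : ℤ) : ℂ) * ((∏ i, S (x (σ i) - x i) : ℝ) : ℂ) := by
        have := continuous_S
        fun_prop
      refine η.integrable.mul_bdd (c := 1) hc.aestronglyMeasurable (ae_of_all _ fun x => ?_)
      rw [norm_mul, Complex.norm_real, Real.norm_eq_abs, Finset.abs_prod]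
      have h1 : ‖((Equiv.Perm.sign σ : ℤ) : ℂ)‖ = 1 := by
        rcases Int.units_eq_one_or (Equiv.Perm.sign σ) with h | h <;> simp [h]
      rw [h1, one_mul]
      exact Finset.prod_le_one (fun i _ => abs_nonneg _) fun i _ => abs_S_le _
  simp_rw [e1, e2]
  exact h

/-- A matrix of Fourier coefficients of an indicator function is positive semidefinite. -/
lemma posSemidef_integral_cos {Λ : Finset ℤ} {A : Set ℝ} (hA : volume A ≠ ∞) :
    (Matrix.of fun j k : Λ => ∫ t in A, Real.cos (2 * Real.pi * ((j.1 : ℝ) - k.1) * t)).PosSemidef := by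
  have hint : ∀ r : ℝ, IntegrableOn (fun t => Real.cos (r * t)) A := by
    intro r
    have : IsFiniteMeasure (volume.restrict A) := ⟨by simpa using hA.lt_top⟩
    exact Integrable.of_bound (by fun_prop) 1 (ae_of_all _ fun t => Real.abs_cos_le_one _)
  refine Matrix.PosSemidef.of_dotProduct_mulVec_nonneg ?_ fun c => ?_
  · ext j k
    simp only [Matrix.conjTranspose_apply, Matrix.of_apply, star_trivial]
    refine integral_congr_ae (ae_of_all _ fun t => ?_)
    simp only
    rw [← Real.cos_neg]
    congr 1; ring
  · have h1 : star c ⬝ᵥ ((Matrix.of fun j k : Λ =>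
        ∫ t in A, Real.cos (2 * Real.pi * ((j.1 : ℝ) - k.1) * t)).mulVec c) =
        ∫ t in A, ((∑ j : Λ, c j * Real.cos (2 * Real.pi * j.1 * t)) ^ 2 +
          (∑ j : Λ, c j * Real.sin (2 * Real.pi * j.1 * t)) ^ 2) := by
      have h2 : ∀ t : ℝ, (∑ j : Λ, c j * Real.cos (2 * Real.pi * j.1 * t)) ^ 2 +
          (∑ j : Λ, c j * Real.sin (2 * Real.pi * j.1 * t)) ^ 2 =
          ∑ j : Λ, ∑ k : Λ, c j * (c k * Real.cos (2 * Real.pi * ((j.1 : ℝ) - k.1) * t)) := by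
        intro t
        rw [sq, sq, Finset.sum_mul_sum, Finset.sum_mul_sum, ← Finset.sum_add_distrib]
        refine Finset.sum_congr rfl fun j _ => ?_
        rw [← Finset.sum_add_distrib]
        refine Finset.sum_congr rfl fun k _ => ?_
        rw [mul_sub, sub_mul, Real.cos_sub]
        ring
      simp_rw [h2]
      rw [integral_finsetSum _ fun j _ => integrable_finsetSum _ fun k _ =>
        ((hint _).const_mul _).const_mul _]
      simp_rw [dotProduct, Matrix.mulVec, dotProduct, Finset.mul_sum]
      refine Finset.sum_congr rfl fun j _ => ?_
      rw [integral_finsetSum _ fun k _ => ((hint _).const_mul _).const_mul _]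
      refine Finset.sum_congr rfl fun k _ => ?_
      rw [integral_const_mul, integral_const_mul]
      simp [mul_comm]
    rw [h1]
    exact integral_nonneg fun t => by positivity

lemma integral_cos_eq_sinc (b x : ℝ) (hb : 0 ≤ b) :
    ∫ t in Set.Ioo (-b) b, Real.cos (2 * Real.pi * x * t) =
      2 * b * Real.sinc (2 * Real.pi * b * x) := by
  have h := congrArg Complex.re (integral_exp_eq_sinc b x hb)
  rw [Complex.ofReal_re] at h
  rw [← h]
  have hi : IntegrableOn (fun t : ℝ => Complex.exp ((2 * Real.pi * x * t : ℝ) * Complex.I))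
      (Set.Ioo (-b) b) := by
    refine Integrable.of_bound (by fun_prop) 1 (ae_of_all _ fun t => ?_)
    rw [Complex.norm_exp_ofReal_mul_I]
  rw [← Complex.reCLM_apply, ← ContinuousLinearMap.integral_comp_comm _ hi]
  simp only [Complex.reCLM_apply, Complex.exp_ofReal_mul_I_re]

/-- The kernel of the discrete sine process on the lattice `aℤ`. -/
def latticeKernel (a : ℝ) : Matrix ℤ ℤ ℝ := Matrix.of fun j k => a * S (a * j - a * k)

lemma latticeKernel_eq_integral {a : ℝ} (ha : 0 < a) (j k : ℤ) : latticeKernel a j k =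
    ∫ t in Set.Ioo (-(a / 2)) (a / 2), Real.cos (2 * Real.pi * ((j : ℝ) - k) * t) := by
  rw [integral_cos_eq_sinc _ _ (by positivity)]
  simp only [latticeKernel, Matrix.of_apply, S]
  rw [show 2 * (a / 2) = a by ring, show 2 * Real.pi * (a / 2) * ((j : ℝ) - k) =
    Real.pi * (a * j - a * k) by ring]

lemma one_eq_integral (j k : ℤ) : (1 : Matrix ℤ ℤ ℝ) j k =
    ∫ t in Set.Ioo (-(1 / 2) : ℝ) (1 / 2), Real.cos (2 * Real.pi * ((j : ℝ) - k) * t) := by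
  rw [integral_cos_eq_sinc _ _ (by positivity)]
  rcases eq_or_ne j k with rfl | h
  · simp
  · have h' : ((j : ℝ) - k) ≠ 0 := sub_ne_zero.2 (by exact_mod_cast h)
    rw [Matrix.one_apply_ne h, Real.sinc_of_ne_zero (by positivity),
      show 2 * Real.pi * (1 / 2) * ((j : ℝ) - k) = ((j - k : ℤ) : ℝ) * Real.pi by push_cast; ring,
      Real.sin_int_mul_pi]
    simp

lemma posSemidef_latticeKernel {a : ℝ} (ha : 0 < a) (Λ : Finset ℤ) :
    ((latticeKernel a).submatrix (Subtype.val : Λ → ℤ) (Subtype.val : Λ → ℤ)).PosSemidef := by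
  convert posSemidef_integral_cos (Λ := Λ) (A := Set.Ioo (-(a / 2)) (a / 2)) (by simp) using 1
  ext j k
  exact latticeKernel_eq_integral ha _ _

/-- The identity corresponds to the indicator of `(-1/2, 1/2)`, so `1 - K` corresponds to the
indicator of the complement of `(-a/2, a/2)` in it. This needs only `a ≤ 1`. -/
lemma posSemidef_one_sub_latticeKernel {a : ℝ} (ha : 0 < a) (ha' : a ≤ 1) (Λ : Finset ℤ) :
    (1 - (latticeKernel a).submatrix (Subtype.val : Λ → ℤ) (Subtype.val : Λ → ℤ)).PosSemidef := by
  have hne : volume (Set.Ioo (-(1 / 2) : ℝ) (1 / 2) \ Set.Ioo (-(a / 2)) (a / 2)) ≠ ∞ :=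
    measure_ne_top_of_subset Set.sdiff_subset (by simp)
  convert posSemidef_integral_cos (Λ := Λ) hne using 1
  ext j k
  have hint : IntegrableOn (fun t => Real.cos (2 * Real.pi * ((j.1 : ℝ) - k.1) * t))
      (Set.Ioo (-(1 / 2) : ℝ) (1 / 2)) :=
    Integrable.of_bound (by fun_prop) 1 (ae_of_all _ fun t => Real.abs_cos_le_one _)
  rw [Matrix.of_apply, setIntegral_sdiff measurableSet_Ioo hint
    (Set.Ioo_subset_Ioo (by linarith) (by linarith)), ← one_eq_integral,
    ← latticeKernel_eq_integral ha]
  change (1 : Matrix Λ Λ ℝ) j k - latticeKernel a j.1 k.1 = _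
  congr 1
  simp only [Matrix.one_apply, Subtype.ext_iff]

lemma det_latticeKernel {n : ℕ} (a : ℝ) (k : Fin n → ℤ) :
    ((latticeKernel a).submatrix k k).det = a ^ n * sineDet (latticePt a k) := by
  have : (latticeKernel a).submatrix k k =
      a • Matrix.of fun i j : Fin n => S (latticePt a k i - latticePt a k j) := rfl
  rw [this, Matrix.det_smul, Fintype.card_fin, sineDet]

end SincKernel

/-! ### The discrete sine process as a point process on `aℤ`, and sufficiency -/

section LatticeProcess

open Filter Topology

variable {a : ℝ}

lemma finite_lattice_mem (ha : 0 < a) {V : Set ℝ} (hV : Bornology.IsBounded V) :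
    {k : ℤ | a * k ∈ V}.Finite := by
  obtain ⟨r, hr⟩ := hV.subset_closedBall 0
  refine (Set.finite_Icc (-⌈r / a⌉) ⌈r / a⌉).subset fun k hk => ?_
  have h1 : |a * k| ≤ r := by simpa using hr hk
  rw [abs_mul, abs_of_pos ha, mul_comm, ← le_div_iff₀ ha] at h1
  have h2 : |(k : ℝ)| ≤ ⌈r / a⌉ := h1.trans (Int.le_ceil _)
  have h3 : |k| ≤ ⌈r / a⌉ := by exact_mod_cast h2
  exact abs_le.1 h3

open Classical in
/-- The configuration of the occupied sites of the lattice `aℤ`. -/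
def latticeConfig (ha : 0 < a) (ω : ℤ → Bool) : Configuration where
  mult x := if ∃ k : ℤ, x = a * k ∧ ω k = true then 1 else 0
  locallyFinite K hK := by
    refine ((finite_lattice_mem ha hK.isBounded).image fun k : ℤ => a * k).subset ?_
    rintro x ⟨hx, h⟩
    rw [ne_eq, ite_eq_right_iff, not_forall] at h
    obtain ⟨⟨k, rfl, _⟩, _⟩ := h
    exact ⟨k, hx, rfl⟩

lemma latticeConfig_mult_eq_one (ha : 0 < a) {ω : ℤ → Bool} {k : ℤ} (hk : ω k = true) :
    (latticeConfig ha ω).mult (a * k) = 1 := if_pos ⟨k, rfl, hk⟩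

lemma exists_of_index (ha : 0 < a) {ω : ℤ → Bool} (j : (latticeConfig ha ω).Index) :
    ∃ k : ℤ, j.1 = a * k ∧ ω k = true := by
  by_contra h
  have h0 : (latticeConfig ha ω).mult j.1 = 0 := if_neg h
  exact (h0 ▸ j.2 : Fin 0).elim0

/-- The site of a point of a lattice configuration. -/
def siteOf (ha : 0 < a) {ω : ℤ → Bool} (j : (latticeConfig ha ω).Index) : ℤ :=
  (exists_of_index ha j).choose

lemma siteOf_spec (ha : 0 < a) {ω : ℤ → Bool} (j : (latticeConfig ha ω).Index) :
    j.1 = a * siteOf ha j ∧ ω (siteOf ha j) = true := (exists_of_index ha j).choose_spec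

open Classical in
lemma siteOf_injective (ha : 0 < a) {ω : ℤ → Bool} :
    Function.Injective (siteOf ha : (latticeConfig ha ω).Index → ℤ) := by
  rintro ⟨x, i⟩ ⟨y, i'⟩ h
  have hx := siteOf_spec ha (⟨x, i⟩ : (latticeConfig ha ω).Index)
  have hy := siteOf_spec ha (⟨y, i'⟩ : (latticeConfig ha ω).Index)
  rw [h] at hx
  obtain rfl : x = y := hx.1.trans hy.1.symm
  have h1 : (latticeConfig ha ω).mult x ≤ 1 := by
    change ite _ _ _ ≤ 1
    split_ifs <;> simp
  congr 1
  ext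
  have := i.2
  have := i'.2
  omega

lemma exists_siteOf_eq (ha : 0 < a) {ω : ℤ → Bool} {k : ℤ} (hk : ω k = true) :
    ∃ j : (latticeConfig ha ω).Index, siteOf ha j = k := by
  refine ⟨⟨a * k, ⟨0, by rw [latticeConfig_mult_eq_one ha hk]; exact one_pos⟩⟩, ?_⟩
  have h := (siteOf_spec ha (⟨a * k, ⟨0, by rw [latticeConfig_mult_eq_one ha hk]; exact one_pos⟩⟩ :
    (latticeConfig ha ω).Index)).1
  have h' : a * (k : ℝ) = a * _ := h
  exact_mod_cast (mul_left_cancel₀ ha.ne' h').symm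

lemma count_latticeConfig (ha : 0 < a) (ω : ℤ → Bool) {V : Set ℝ} (hV : Bornology.IsBounded V) :
    (latticeConfig ha ω).count V =
      ((∑ k ∈ (finite_lattice_mem ha hV).toFinset, if ω k = true then 1 else 0 : ℕ) : ℕ∞) := by
  have h1 : siteOf ha '' {j : (latticeConfig ha ω).Index | j.1 ∈ V} =
      ((finite_lattice_mem ha hV).toFinset.filter fun k => ω k = true : Finset ℤ) := by
    ext k
    simp only [Set.mem_image, Set.mem_ofPred_eq, Finset.coe_filter, Set.Finite.mem_toFinset]
    constructor
    · rintro ⟨j, hj, rfl⟩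
      obtain ⟨h1, h2⟩ := siteOf_spec ha j
      exact ⟨h1 ▸ hj, h2⟩
    · rintro ⟨h1, h2⟩
      obtain ⟨j, rfl⟩ := exists_siteOf_eq ha h2
      exact ⟨j, (siteOf_spec ha j).1 ▸ h1, rfl⟩
  rw [Configuration.count, ← (siteOf_injective ha).encard_image, h1, Set.encard_coe_eq_coe_finsetCard,
    Finset.card_filter]

lemma measurable_latticeConfig (ha : 0 < a) : Measurable (latticeConfig ha) := by
  refine measurable_generateFrom ?_
  rintro s ⟨V, m, hV, hVb, rfl⟩
  have h : Measurable fun ω : ℤ → Bool =>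
      (∑ k ∈ (finite_lattice_mem ha hVb).toFinset, if ω k = true then 1 else 0 : ℕ) := by
    refine Finset.measurable_fun_sum _ fun k _ => ?_
    exact (measurable_of_countable fun b : Bool => if b = true then (1 : ℕ) else 0).comp
      (measurable_pi_apply k)
  have : latticeConfig ha ⁻¹' {u | u.count V = m} = (fun ω : ℤ → Bool =>
      (∑ k ∈ (finite_lattice_mem ha hVb).toFinset, if ω k = true then 1 else 0 : ℕ)) ⁻¹' {m} := by
    ext ω
    simp only [Set.mem_preimage, Set.mem_ofPred_eq, Set.mem_singleton_iff,
      count_latticeConfig ha ω hVb, Nat.cast_inj]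
  rw [this]
  exact h (measurableSet_singleton m)

/-- The sum over distinct labels of a lattice configuration, as a sum over lattice points. -/
def latticeTerm {n : ℕ} (a : ℝ) (φ : EuclideanSpace ℝ (Fin n) → ℂ) (k : Fin n → ℤ) (ω : ℤ → Bool) :
    ℂ := open Classical in
  if Function.Injective k then
    (occupied (Finset.univ.image k)).indicator (fun _ => φ (latticePt a k)) ω else 0

lemma distinctSum_latticeConfig {n : ℕ} (ha : 0 < a) (φ : EuclideanSpace ℝ (Fin n) → ℂ)
    (ω : ℤ → Bool) :
    distinctSum φ (latticeConfig ha ω) = ∑' k : Fin n → ℤ, latticeTerm a φ k ω := by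
  let g : (Fin n ↪ (latticeConfig ha ω).Index) → (Fin n → ℤ) := fun j i => siteOf ha (j i)
  have hg : Function.Injective g := by
    intro j j' h
    ext i : 1
    exact siteOf_injective ha (congrFun h i)
  have hsupp : Function.support (fun k => latticeTerm a φ k ω) ⊆ Set.range g := by
    intro k hk
    rw [Function.mem_support, latticeTerm] at hk
    split_ifs at hk with hinj
    · have hω : ω ∈ occupied (Finset.univ.image k) := by
        by_contra h
        exact hk (Set.indicator_of_notMem h _)
      choose j hj using fun i => exists_siteOf_eq ha (hω (k i) (by simp))
      refine ⟨⟨j, fun i i' h => hinj ?_⟩, funext hj⟩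
      rw [← hj i, ← hj i', h]
    · exact absurd rfl hk
  rw [← hg.tsum_eq hsupp, distinctSum]
  refine tsum_congr fun j => ?_
  have hinj : Function.Injective (g j) := fun i i' h => j.injective (siteOf_injective ha h)
  have hω : ω ∈ occupied (Finset.univ.image (g j)) := by
    intro k hk
    obtain ⟨i, -, rfl⟩ := Finset.mem_image.1 hk
    exact (siteOf_spec ha (j i)).2
  rw [latticeTerm, if_pos hinj, Set.indicator_of_mem hω]
  congr 2
  ext i
  exact (siteOf_spec ha (j i)).1

lemma measurable_latticeTerm {n : ℕ} (a : ℝ) (φ : EuclideanSpace ℝ (Fin n) → ℂ) (k : Fin n → ℤ) :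
    Measurable (latticeTerm a φ k) := by
  unfold latticeTerm
  split_ifs
  · exact measurable_const.indicator (measurableSet_occupied _)
  · exact measurable_const

lemma norm_latticeTerm_le {n : ℕ} (a : ℝ) (φ : EuclideanSpace ℝ (Fin n) → ℂ) (k : Fin n → ℤ)
    (ω : ℤ → Bool) : ‖latticeTerm a φ k ω‖ ≤ ‖φ (latticePt a k)‖ := by
  unfold latticeTerm
  split_ifs
  · exact norm_indicator_le_norm_self _ _
  · simp

/-- The occupation variables of a configuration at the sites of the lattice `aℤ`. -/
def readout (a : ℝ) (u : Configuration) (k : ℤ) : Bool :=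
  open Classical in decide (u.count {a * (k : ℝ)} = (1 : ℕ))

lemma measurableSet_count_eq {V : Set ℝ} (hV : MeasurableSet V) (hVb : Bornology.IsBounded V)
    (m : ℕ) : MeasurableSet {u : Configuration | u.count V = m} :=
  MeasurableSpace.measurableSet_generateFrom ⟨V, m, hV, hVb, rfl⟩

lemma measurable_readout (a : ℝ) : Measurable (readout a) := by
  refine measurable_pi_lambda _ fun k => measurable_to_bool ?_
  convert measurableSet_count_eq (measurableSet_singleton (a * (k : ℝ)))
    Bornology.isBounded_singleton 1 using 1
  ext u
  simp [readout]

/-- The configurations without multiple points that are contained in the lattice `aℤ`. -/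
def simpleLattice (a : ℝ) : Set Configuration :=
  (⋂ N : ℕ, {u | u.count (Set.Icc (-N : ℝ) N \ Set.range fun k : ℤ => a * (k : ℝ)) = (0 : ℕ)}) ∩
    ⋂ k : ℤ, ({u | u.count {a * (k : ℝ)} = (0 : ℕ)} ∪ {u | u.count {a * (k : ℝ)} = (1 : ℕ)})

lemma measurableSet_simpleLattice (a : ℝ) : MeasurableSet (simpleLattice a) := by
  refine (MeasurableSet.iInter fun N => measurableSet_count_eq ?_ ?_ _).inter
    (MeasurableSet.iInter fun k => (measurableSet_count_eq (measurableSet_singleton _)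
      Bornology.isBounded_singleton _).union (measurableSet_count_eq (measurableSet_singleton _)
      Bornology.isBounded_singleton _))
  · exact measurableSet_Icc.diff (Set.countable_range _).measurableSet
  · exact (Metric.isBounded_Icc _ _).subset Set.sdiff_subset

lemma count_singleton (u : Configuration) (x : ℝ) : u.count {x} = u.mult x := by
  have : {j : u.Index | j.1 ∈ ({x} : Set ℝ)} =
      Set.range fun i : Fin (u.mult x) => (⟨x, i⟩ : u.Index) := by
    ext ⟨y, i⟩
    constructor
    · intro h
      obtain rfl : y = x := h
      exact ⟨i, rfl⟩
    · rintro ⟨i', h⟩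
      exact (congrArg Sigma.fst h).symm
  rw [Configuration.count, this, ← Set.image_univ, Function.Injective.encard_image, Set.encard_univ]
  · simp
  · intro i i' h
    simpa using h

lemma exists_site_of_simpleLattice {u : Configuration} (hu : u ∈ simpleLattice a) {x : ℝ}
    (hx : u.mult x ≠ 0) : ∃ k : ℤ, x = a * k := by
  by_contra h
  obtain ⟨N, hN⟩ := exists_nat_ge |x|
  have h0 := Set.mem_iInter.1 hu.1 N
  rw [Set.mem_ofPred_eq, Configuration.count, Nat.cast_zero, Set.encard_eq_zero] at h0
  have : (⟨x, ⟨0, Nat.pos_of_ne_zero hx⟩⟩ : u.Index) ∈ {j : u.Index | j.1 ∈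
      Set.Icc (-N : ℝ) N \ Set.range fun k : ℤ => a * (k : ℝ)} := by
    refine ⟨abs_le.1 hN, ?_⟩
    rintro ⟨k, hk⟩
    exact h ⟨k, hk.symm⟩
  rw [h0] at this
  exact this

open Classical in
-- Supplies the measurability that `distinctSum` does not have for free: on the measurable,
-- full-measure set `simpleLattice a`, a configuration is a function of its measurable occupation
-- variables.
lemma latticeConfig_readout (ha : 0 < a) {u : Configuration} (hu : u ∈ simpleLattice a) :
    latticeConfig ha (readout a u) = u := by
  ext x
  have hr : ∀ k : ℤ, readout a u k = true ↔ u.mult (a * k) = 1 := by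
    intro k
    rw [readout, decide_eq_true_eq, count_singleton, Nat.cast_inj]
  have hk : ∀ k : ℤ, u.mult (a * k) = 0 ∨ u.mult (a * k) = 1 := by
    intro k
    have := Set.mem_iInter.1 hu.2 k
    simpa only [Set.mem_union, Set.mem_ofPred_eq, count_singleton, Nat.cast_inj] using this
  change ite _ _ _ = _
  split_ifs with h
  · obtain ⟨k, rfl, h⟩ := h
    exact ((hr k).1 h).symm
  · by_contra hne
    obtain ⟨k, rfl⟩ := exists_site_of_simpleLattice hu (Ne.symm hne)
    exact h ⟨k, rfl, (hr k).2 ((hk k).resolve_left (Ne.symm hne))⟩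

open Classical in
lemma latticeConfig_mem_simpleLattice (ha : 0 < a) (ω : ℤ → Bool) :
    latticeConfig ha ω ∈ simpleLattice a := by
  constructor
  · refine Set.mem_iInter.2 fun N => ?_
    rw [Set.mem_ofPred_eq, Configuration.count, Nat.cast_zero, Set.encard_eq_zero,
      Set.eq_empty_iff_forall_notMem]
    rintro j ⟨-, hj⟩
    exact hj ⟨siteOf ha j, (siteOf_spec ha j).1.symm⟩
  · refine Set.mem_iInter.2 fun k => ?_
    simp only [Set.mem_union, Set.mem_ofPred_eq, count_singleton, Nat.cast_inj]
    change ite _ _ _ = 0 ∨ ite _ _ _ = 1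
    split_ifs <;> simp

/-- The point process of the occupied lattice sites. -/
def latticeProcess (ha : 0 < a) (μ : ProbabilityMeasure (ℤ → Bool)) : PointProcess :=
  μ.map (measurable_latticeConfig ha).aemeasurable

lemma ae_mem_simpleLattice (ha : 0 < a) (μ : ProbabilityMeasure (ℤ → Bool)) :
    ∀ᵐ u ∂(latticeProcess ha μ : Measure Configuration), u ∈ simpleLattice a := by
  change ∀ᵐ u ∂(Measure.map (latticeConfig ha) μ), u ∈ simpleLattice a
  refine (ae_map_iff (p := fun u => u ∈ simpleLattice a)
    (measurable_latticeConfig ha).aemeasurable (measurableSet_simpleLattice a)).2 ?_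
  exact ae_of_all _ fun ω => latticeConfig_mem_simpleLattice ha ω

lemma supportedOnLattice_latticeProcess (ha : 0 < a) (μ : ProbabilityMeasure (ℤ → Bool)) :
    SupportedOnLattice (latticeProcess ha μ) a := by
  filter_upwards [ae_mem_simpleLattice ha μ] with u hu x hx
  exact exists_site_of_simpleLattice hu hx

lemma uniformLocalMoments_latticeProcess (ha : 0 < a) (μ : ProbabilityMeasure (ℤ → Bool)) :
    UniformLocalMoments (latticeProcess ha μ) := by
  intro n hn
  refine ⟨((⌈1 / a⌉₊ + 1 : ℕ) : ℝ≥0) ^ n, fun L => ?_⟩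
  have hb : Bornology.IsBounded (Set.Icc L (L + 1)) := Metric.isBounded_Icc _ _
  have hcard : (finite_lattice_mem ha hb).toFinset.card ≤ ⌈1 / a⌉₊ + 1 := by
    have hsub : (finite_lattice_mem ha hb).toFinset ⊆
        Finset.Icc ⌈L / a⌉ (⌈L / a⌉ + ⌈1 / a⌉₊) := by
      intro k hk
      have hk' : a * (k : ℝ) ∈ Set.Icc L (L + 1) := by simpa using hk
      rw [Finset.mem_Icc]
      constructor
      · rw [Int.ceil_le, div_le_iff₀ ha]; linarith [hk'.1]
      · have h1 : (k : ℝ) ≤ L / a + 1 / a := by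
          rw [← add_div, le_div_iff₀ ha]; linarith [hk'.2]
        have h2 : (k : ℝ) ≤ ((⌈L / a⌉ + ⌈1 / a⌉₊ : ℤ) : ℝ) := by
          push_cast
          linarith [Int.le_ceil (L / a), Nat.le_ceil (1 / a)]
        exact_mod_cast h2
    refine (Finset.card_le_card hsub).trans ?_
    rw [Int.card_Icc]
    omega
  have hcount : ∀ᵐ u ∂(latticeProcess ha μ : Measure Configuration),
      (u.count (Set.Icc L (L + 1)) : ℝ≥0∞) ^ n ≤ ((⌈1 / a⌉₊ + 1 : ℕ) : ℝ≥0∞) ^ n := by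
    filter_upwards [ae_mem_simpleLattice ha μ] with u hu
    rw [← latticeConfig_readout ha hu, count_latticeConfig ha _ hb]
    refine pow_le_pow_left' ?_ n
    have : (∑ k ∈ (finite_lattice_mem ha hb).toFinset, if readout a u k = true then 1 else 0) ≤
        ⌈1 / a⌉₊ + 1 := by
      rw [← Finset.card_filter]
      exact (Finset.card_filter_le _ _).trans hcard
    exact_mod_cast this
  refine (lintegral_mono_ae hcount).trans ?_
  rw [lintegral_const, measure_univ, mul_one]
  simp

/-- Absolute summability permits integration term by term; the expectation of a term with distinct
sites is a principal minor of the kernel. -/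
lemma integral_distinctSum_latticeProcess {n : ℕ} (ha : 0 < a) (μ : ProbabilityMeasure (ℤ → Bool))
    (hμ : ∀ C : Finset ℤ, (μ : Measure (ℤ → Bool)) (occupied C) = ENNReal.ofReal
      ((latticeKernel a).submatrix (Subtype.val : C → ℤ) (Subtype.val : C → ℤ)).det)
    {φ : EuclideanSpace ℝ (Fin n) → ℂ} (hφ : Summable fun k : Fin n → ℤ => ‖φ (latticePt a k)‖) :
    ∫ u, distinctSum φ u ∂(latticeProcess ha μ : Measure Configuration) =
      ∑' k : Fin n → ℤ, φ (latticePt a k) * ((a ^ n * sineDet (latticePt a k) : ℝ) : ℂ) := by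
  have hsum : ∀ ω, Summable fun k => latticeTerm a φ k ω := fun ω =>
    Summable.of_norm_bounded hφ fun k => norm_latticeTerm_le a φ k ω
  have hGm : Measurable fun ω => ∑' k : Fin n → ℤ, latticeTerm a φ k ω := by
    refine measurable_of_tendsto_metrizable' (atTop : Filter (Finset (Fin n → ℤ)))
      (f := fun s ω => ∑ k ∈ s, latticeTerm a φ k ω)
      (fun s => Finset.measurable_fun_sum _ fun k _ => measurable_latticeTerm a φ k) ?_
    exact tendsto_pi_nhds.2 fun ω => (hsum ω).hasSum
  have haesm : AEStronglyMeasurable (distinctSum φ)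
      (Measure.map (latticeConfig ha) (μ : Measure (ℤ → Bool))) := by
    have h1 : Measurable fun u => ∑' k : Fin n → ℤ, latticeTerm a φ k (readout a u) :=
      hGm.comp (measurable_readout a)
    refine h1.aestronglyMeasurable.congr ?_
    filter_upwards [ae_mem_simpleLattice ha μ] with u hu
    rw [← distinctSum_latticeConfig ha, latticeConfig_readout ha hu]
  change ∫ u, distinctSum φ u ∂(Measure.map (latticeConfig ha) (μ : Measure (ℤ → Bool))) = _
  rw [integral_map (measurable_latticeConfig ha).aemeasurable haesm]
  simp_rw [distinctSum_latticeConfig]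
  have hint : ∀ k, Integrable (latticeTerm a φ k) (μ : Measure (ℤ → Bool)) := fun k =>
    Integrable.of_bound (measurable_latticeTerm a φ k).aestronglyMeasurable _
      (ae_of_all _ fun ω => norm_latticeTerm_le a φ k ω)
  rw [← integral_tsum_of_summable_integral_norm hint]
  · refine tsum_congr fun k => ?_
    by_cases hk : Function.Injective k
    · simp only [latticeTerm, if_pos hk]
      rw [integral_indicator_const _ (measurableSet_occupied _), measureReal_def, hμ]
      have hdet : ((latticeKernel a).submatrix
          (Subtype.val : ↥(Finset.univ.image k) → ℤ) (Subtype.val : ↥(Finset.univ.image k) → ℤ)).det =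
          a ^ n * sineDet (latticePt a k) := by
        rw [← det_latticeKernel]
        let e : Fin n ≃ ↥(Finset.univ.image k) := Equiv.ofBijective
          (fun i => ⟨k i, Finset.mem_image_of_mem k (Finset.mem_univ i)⟩)
          ⟨fun i i' h => hk (congrArg Subtype.val h), by
            rintro ⟨x, hx⟩
            obtain ⟨i, -, rfl⟩ := Finset.mem_image.1 hx
            exact ⟨i, rfl⟩⟩
        rw [← Matrix.det_submatrix_equiv_self e]
        rfl
      have hnn := (posSemidef_latticeKernel ha (Finset.univ.image k)).det_nonneg
      rw [ENNReal.toReal_ofReal hnn, hdet, Complex.real_smul, mul_comm]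
    -- Tuples with a repeated site are absent from the process sum; on the other side they drop out
    -- because two rows of the determinant coincide.
    · have h0 : sineDet (latticePt a k) = 0 := by
        rw [Function.not_injective_iff] at hk
        obtain ⟨i, i', h, hne⟩ := hk
        refine Matrix.det_zero_of_row_eq hne ?_
        ext l
        simp [h]
      simp [latticeTerm, if_neg hk, h0]
  · refine Summable.of_nonneg_of_le (fun k => integral_nonneg fun _ => norm_nonneg _) (fun k => ?_) hφ
    refine (integral_mono (hint k).norm (integrable_const _)
      fun ω => norm_latticeTerm_le a φ k ω).trans ?_
    simp

/-- For `a ≤ 1/2` the discrete sine process on `aℤ` mimics the sine process. -/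
theorem exists_lattice_mimicry {z : PointProcess} (hz : IsSineProcess z) (ha : 0 < a)
    (ha' : a ≤ 1 / 2) :
    ∃ v : PointProcess, UniformLocalMoments v ∧ SupportedOnLattice v a ∧
      Mimics v z (1 / (2 * a)) := by
  obtain ⟨μ, hμ⟩ := exists_determinantal (latticeKernel a) (posSemidef_latticeKernel ha)
    (posSemidef_one_sub_latticeKernel ha (by linarith))
  have hulm := uniformLocalMoments_latticeProcess ha μ
  refine ⟨latticeProcess ha μ, hulm, supportedOnLattice_latticeProcess ha μ, hulm,
    hz.uniformLocalMoments, fun n hn η hη => ?_⟩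
  rw [hz.integral_distinctSum hn η.continuous η.integrable,
    integral_distinctSum_latticeProcess ha μ hμ (summable_norm_lattice ha η)]
  exact (hasSum_lattice_sineDet ha ha' hη).tsum_eq.symm

end LatticeProcess

/-! ### Finite-dimensional approximation of the Fredholm expansion -/

section Fredholm

open Filter Topology Matrix
open scoped ComplexOrder

/-- The points of the uniform grid with `N` points on `[-1/2, 1/2)`. -/
def gridPt (N : ℕ) (p : Fin N) : ℝ := p / N - 1 / 2

/-- The left Riemann sum of `h` on `[-1/2, 1/2]` with `N` points. -/
def gridMean (N : ℕ) (h : ℝ → ℂ) : ℂ := (N : ℂ)⁻¹ * ∑ p : Fin N, h (gridPt N p)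

lemma tendsto_gridMean {h : ℝ → ℂ} (hc : Continuous h) :
    Tendsto (fun N => gridMean N h) atTop (𝓝 (∫ t in (-(1 / 2) : ℝ)..(1 / 2), h t)) := by
  rw [Metric.tendsto_atTop]
  intro ε hε
  have huc := (isCompact_Icc (a := (-(1 / 2) : ℝ)) (b := 1 / 2)).uniformContinuousOn_of_continuous
    hc.continuousOn
  obtain ⟨δ, hδ, hδ'⟩ := Metric.uniformContinuousOn_iff.1 huc (ε / 2) (by positivity)
  obtain ⟨N₀, hN₀⟩ := exists_nat_gt (1 / δ)
  refine ⟨N₀ + 1, fun N hN => ?_⟩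
  have hNpos : (0 : ℝ) < N := by
    have : 0 < N := by omega
    exact_mod_cast this
  have hNδ : 1 / (N : ℝ) < δ := by
    rw [div_lt_comm₀ hNpos hδ]
    refine hN₀.trans ?_
    exact_mod_cast (show N₀ < N by omega)
  let c : ℕ → ℝ := fun k => k / N - 1 / 2
  have hsplit : ∫ t in (-(1 / 2) : ℝ)..(1 / 2), h t =
      ∑ k ∈ Finset.range N, ∫ t in c k..c (k + 1), h t := by
    rw [intervalIntegral.sum_integral_adjacent_intervals fun k _ => hc.intervalIntegrable _ _]
    congr 1
    · simp [c]
    · simp only [c]; rw [div_self hNpos.ne']; norm_num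
  have hmean : gridMean N h = ∑ k ∈ Finset.range N, ∫ _t in c k..c (k + 1), h (c k) := by
    rw [gridMean, Finset.mul_sum, Finset.sum_range]
    refine Finset.sum_congr rfl fun p _ => ?_
    rw [intervalIntegral.integral_const, Complex.real_smul]
    congr 1
    simp only [c]
    push_cast
    ring
  rw [dist_eq_norm, hmean, hsplit, ← Finset.sum_sub_distrib]
  have hterm : ∀ k ∈ Finset.range N, ‖(∫ _t in c k..c (k + 1), h (c k)) -
      ∫ t in c k..c (k + 1), h t‖ ≤ ε / 2 * (1 / N) := by
    intro k hk
    have hk' : (k : ℝ) + 1 ≤ N := by exact_mod_cast Finset.mem_range.1 hk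
    have hck : c (k + 1) - c k = 1 / N := by simp only [c]; push_cast; ring
    have hck0 : -(1 / 2) ≤ c k := by
      have : (0 : ℝ) ≤ k / N := by positivity
      simp only [c]; linarith
    have hck1 : c (k + 1) ≤ 1 / 2 := by
      have : ((k : ℝ) + 1) / N ≤ 1 := (div_le_one hNpos).2 hk'
      simp only [c]; push_cast; linarith
    have hle : c k ≤ c (k + 1) := by
      have : (0 : ℝ) < 1 / N := by positivity
      linarith
    rw [← intervalIntegral.integral_sub (by simp) (hc.intervalIntegrable _ _)]
    refine (intervalIntegral.norm_integral_le_of_norm_le_const (C := ε / 2) fun t ht => ?_).trans ?_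
    · rw [Set.uIoc_of_le hle] at ht
      rw [← dist_eq_norm]
      refine (hδ' _ ⟨hck0, by linarith⟩ _ ⟨by linarith [ht.1], by linarith [ht.2]⟩ ?_).le
      rw [Real.dist_eq, abs_sub_comm, abs_of_nonneg (by linarith [ht.1])]
      linarith [ht.2]
    · rw [hck, abs_of_pos (by positivity)]
  refine (norm_sum_le _ _).trans_lt ((Finset.sum_le_sum hterm).trans_lt ?_)
  rw [Finset.sum_const, Finset.card_range, nsmul_eq_mul]
  field_simp
  norm_num

/-- The plane wave `exp (2 π i x t)`. -/
def wave (x t : ℝ) : ℂ := Complex.exp ((2 * Real.pi * x * t : ℝ) * Complex.I)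

lemma norm_wave (x t : ℝ) : ‖wave x t‖ = 1 := Complex.norm_exp_ofReal_mul_I _

lemma continuous_wave : Continuous fun p : ℝ × ℝ => wave p.1 p.2 := by
  unfold wave; fun_prop

lemma wave_add_left (x y t : ℝ) : wave (x + y) t = wave x t * wave y t := by
  rw [wave, wave, wave, ← Complex.exp_add]; congr 1; push_cast; ring

lemma wave_add_right (x s t : ℝ) : wave x (s + t) = wave x s * wave x t := by
  rw [wave, wave, wave, ← Complex.exp_add]; congr 1; push_cast; ring

lemma conj_wave (x t : ℝ) : (starRingEnd ℂ) (wave x t) = wave (-x) t := by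
  rw [wave, wave, ← Complex.exp_conj, map_mul, Complex.conj_ofReal, Complex.conj_I]
  congr 1; push_cast; ring

lemma wave_neg_left (x t : ℝ) : wave (-x) t = wave x (-t) := by
  rw [wave, wave]; congr 1; push_cast; ring

/-- The kernel of the projection onto the plane waves with frequencies in the grid. -/
def gridKernel (N : ℕ) (x : ℝ) : ℂ := gridMean N (wave x)

lemma tendsto_gridKernel (x : ℝ) : Tendsto (fun N => gridKernel N x) atTop (𝓝 (S x : ℂ)) := by
  have h := tendsto_gridMean (h := wave x) (by have := continuous_wave; fun_prop)
  rwa [intervalIntegral.integral_of_le (by norm_num), integral_Ioc_eq_integral_Ioo,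
    show ∫ t in Set.Ioo (-(1 / 2) : ℝ) (1 / 2), wave x t = S x from integral_exp_eq_S x] at h

/-- The determinant of the grid kernel. -/
def gridDet (N : ℕ) {n : ℕ} (x : Fin n → ℝ) : ℂ :=
  (Matrix.of fun i j => gridKernel N (x i - x j)).det

lemma continuous_gridDet (N n : ℕ) : Continuous (gridDet N (n := n)) := by
  unfold gridDet gridKernel gridMean
  have := continuous_wave
  refine Continuous.matrix_det (continuous_matrix fun i j => ?_)
  simp only [Matrix.of_apply]
  fun_prop

lemma tendsto_gridDet {n : ℕ} (x : Fin n → ℝ) :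
    Tendsto (fun N => gridDet N x) atTop (𝓝 (sineDet (WithLp.toLp 2 x) : ℂ)) := by
  have h1 : (sineDet (WithLp.toLp 2 x) : ℂ) =
      (Matrix.of fun i j => (S (x i - x j) : ℂ)).det := by
    rw [sineDet, ← Complex.ofRealHom_eq_coe, RingHom.map_det]
    rfl
  rw [h1]
  have h2 : Tendsto (fun N => Matrix.of fun i j => gridKernel N (x i - x j)) atTop
      (𝓝 (Matrix.of fun i j => (S (x i - x j) : ℂ))) := by
    refine tendsto_pi_nhds.2 fun i => tendsto_pi_nhds.2 fun j => ?_
    exact tendsto_gridKernel _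
  exact ((Continuous.matrix_det continuous_id).tendsto _).comp h2

/-- Hadamard's bound through eigenvalues: `λ ≤ exp(λ - 1)`, and the eigenvalues sum to the trace
`n`. -/
lemma norm_det_le_one_of_posSemidef {n : ℕ} {M : Matrix (Fin n) (Fin n) ℂ}
    (hM : M.PosSemidef) (h1 : ∀ i, M i i = 1) : ‖M.det‖ ≤ 1 := by
  have htr : ∑ i, hM.1.eigenvalues i = n := by
    have h := hM.1.trace_eq_sum_eigenvalues
    simp only [Matrix.trace, Matrix.diag, h1] at h
    have h' : ((∑ i, hM.1.eigenvalues i : ℝ) : ℂ) = ((n : ℝ) : ℂ) := by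
      rw [Complex.ofReal_sum]; simpa using h.symm
    exact_mod_cast h'
  rw [hM.1.det_eq_prod_eigenvalues, norm_prod]
  calc ∏ i, ‖((hM.1.eigenvalues i : ℝ) : ℂ)‖ ≤ ∏ i, Real.exp (hM.1.eigenvalues i - 1) := by
        refine Finset.prod_le_prod (fun i _ => norm_nonneg _) fun i _ => ?_
        rw [Complex.norm_real, Real.norm_of_nonneg (hM.eigenvalues_nonneg i)]
        linarith [Real.add_one_le_exp (hM.1.eigenvalues i - 1)]
    _ = 1 := by
        rw [← Real.exp_sum, Finset.sum_sub_distrib, htr]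
        simp

/-- The matrix is a Gram matrix of normalized plane waves with unit diagonal. A bound without `n!`
makes the Fredholm series converge uniformly in `N`. -/
lemma norm_gridDet_le {N : ℕ} (hN : 0 < N) {n : ℕ} (x : Fin n → ℝ) : ‖gridDet N x‖ ≤ 1 := by
  have hN' : (N : ℂ) ≠ 0 := by exact_mod_cast hN.ne'
  let U : Matrix (Fin n) (Fin N) ℂ := Matrix.of fun i p => wave (x i) (gridPt N p)
  have hU : (Matrix.of fun i j => gridKernel N (x i - x j)) = ((N : ℝ)⁻¹) • (U * Uᴴ) := by
    ext i j
    simp only [Matrix.of_apply, gridKernel, gridMean, Matrix.smul_apply, Matrix.mul_apply,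
      Matrix.conjTranspose_apply, U, RCLike.star_def, conj_wave, Complex.real_smul]
    push_cast
    congr 1
    refine Finset.sum_congr rfl fun p _ => ?_
    rw [← wave_add_left, sub_eq_add_neg]
  rw [gridDet]
  refine norm_det_le_one_of_posSemidef ?_ fun i => ?_
  · rw [hU]
    exact (Matrix.posSemidef_self_mul_conjTranspose U).smul (by positivity)
  · simp [gridKernel, gridMean, wave, hN']

/-- The matrix of multiplication by `f`, in the basis of plane waves with frequencies in the
grid. -/
def gridMatrix (N : ℕ) (f : ℝ → ℝ) : Matrix (Fin N) (Fin N) ℂ :=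
  Matrix.of fun p q => (N : ℂ)⁻¹ * ∫ x, (f x : ℂ) * wave x (gridPt N p - gridPt N q)

/-- The integral of a product against the determinant of the grid kernel. -/
def gridCorr (N n : ℕ) (f : ℝ → ℝ) : ℂ := ∫ x : Fin n → ℝ, (∏ i, (f (x i) : ℂ)) * gridDet N x

lemma integrable_mul_wave {f : ℝ → ℝ} (hf : Integrable f) (t : ℝ) :
    Integrable fun x => (f x : ℂ) * wave x t := by
  have := continuous_wave
  exact hf.ofReal.mul_bdd (c := 1) (by fun_prop)
    (ae_of_all _ fun x => (norm_wave x t).le)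

lemma gridDet_eq_sum (N : ℕ) {n : ℕ} (x : Fin n → ℝ) :
    gridDet N x = ∑ m : Fin n → Fin N, ∑ σ : Equiv.Perm (Fin n), ((Equiv.Perm.sign σ : ℤ) : ℂ) *
      ∏ i, ((N : ℂ)⁻¹ * wave (x i) (gridPt N (m (σ i)) - gridPt N (m i))) := by
  -- Replacing `σ` by `σ⁻¹` moves the permutation from the points to the frequencies, so that the
  -- integral over `x` factors.
  rw [gridDet, Matrix.det_apply', Finset.sum_comm, ← Equiv.sum_comp (Equiv.inv _)]
  refine Finset.sum_congr rfl fun σ _ => ?_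
  simp only [Equiv.inv_apply, Equiv.Perm.sign_inv, Matrix.of_apply, gridKernel, gridMean]
  rw [← Finset.mul_sum]
  congr 1
  simp_rw [Finset.mul_sum]
  rw [Finset.prod_univ_sum, Fintype.piFinset_univ]
  refine Finset.sum_congr rfl fun m _ => ?_
  have h : ∀ y : Fin n → ℝ, ∏ i, wave (x (σ⁻¹ i)) (y i) = ∏ i, wave (x i) (y (σ i)) := by
    intro y
    rw [← Equiv.prod_comp σ]
    simp
  simp_rw [sub_eq_add_neg, wave_add_left, wave_add_right, Finset.prod_mul_distrib, h,
    wave_neg_left]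

/-- A Cauchy–Binet type duality: a determinant in position space, integrated against `∏ f(x_i)`,
becomes a sum of principal minors in frequency space. -/
lemma gridCorr_eq_sum (N n : ℕ) {f : ℝ → ℝ} (hf : Integrable f) :
    gridCorr N n f = ∑ m : Fin n → Fin N, ((gridMatrix N f).submatrix m m).det := by
  have hterm : ∀ (m : Fin n → Fin N) (σ : Equiv.Perm (Fin n)) (x : Fin n → ℝ),
      (∏ i, (f (x i) : ℂ)) * (((Equiv.Perm.sign σ : ℤ) : ℂ) *
      ∏ i, ((N : ℂ)⁻¹ * wave (x i) (gridPt N (m (σ i)) - gridPt N (m i)))) =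
      ((Equiv.Perm.sign σ : ℤ) : ℂ) * ∏ i, ((N : ℂ)⁻¹ * ((f (x i) : ℂ) *
        wave (x i) (gridPt N (m (σ i)) - gridPt N (m i)))) := by
    intro m σ x
    rw [mul_left_comm, ← Finset.prod_mul_distrib]
    congr 1
    refine Finset.prod_congr rfl fun i _ => ?_
    ring
  have hint : ∀ (m : Fin n → Fin N) (σ : Equiv.Perm (Fin n)), Integrable fun x : Fin n → ℝ =>
      ((Equiv.Perm.sign σ : ℤ) : ℂ) * ∏ i, ((N : ℂ)⁻¹ * ((f (x i) : ℂ) *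
        wave (x i) (gridPt N (m (σ i)) - gridPt N (m i)))) := by
    intro m σ
    exact (Integrable.fintype_prod (f := fun i x => (N : ℂ)⁻¹ * ((f x : ℂ) *
      wave x (gridPt N (m (σ i)) - gridPt N (m i))))
      fun i => (integrable_mul_wave hf _).const_mul _).const_mul _
  unfold gridCorr
  simp_rw [gridDet_eq_sum, Finset.mul_sum, hterm]
  rw [integral_finsetSum _ fun m _ => integrable_finsetSum _ fun σ _ => hint m σ]
  refine Finset.sum_congr rfl fun m _ => ?_
  rw [integral_finsetSum _ fun σ _ => hint m σ, Matrix.det_apply']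
  refine Finset.sum_congr rfl fun σ _ => ?_
  rw [integral_const_mul, integral_fintype_prod_volume_eq_prod (fun i x => (N : ℂ)⁻¹ * ((f x : ℂ) *
      wave x (gridPt N (m (σ i)) - gridPt N (m i))))]
  congr 1
  refine Finset.prod_congr rfl fun i _ => ?_
  rw [integral_const_mul]
  rfl

lemma norm_gridCorr_le {N : ℕ} (hN : 0 < N) (n : ℕ) (f : ℝ → ℝ) (hf : Integrable f) :
    ‖gridCorr N n f‖ ≤ (∫ x, |f x|) ^ n := by
  have h1 : (∫ x, |f x|) ^ n = ∫ x : Fin n → ℝ, ∏ i, |f (x i)| := by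
    rw [integral_fintype_prod_volume_eq_prod (fun _ x => |f x|)]; simp
  rw [h1]
  refine norm_integral_le_of_norm_le (Integrable.fintype_prod (f := fun _ x => |f x|)
    fun _ => hf.abs) (ae_of_all _ fun x => ?_)
  rw [norm_mul, norm_prod]
  simp only [Complex.norm_real, Real.norm_eq_abs]
  exact mul_le_of_le_one_right (Finset.prod_nonneg fun i _ => abs_nonneg _) (norm_gridDet_le hN x)

lemma tendsto_gridCorr (n : ℕ) {f : ℝ → ℝ} (hf : Integrable f) :
    Tendsto (fun N => gridCorr N n f) atTop
      (𝓝 ((∫ x : Fin n → ℝ, (∏ i, f (x i)) * sineDet (WithLp.toLp 2 x) : ℝ) : ℂ)) := by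
  rw [← integral_complex_ofReal]
  have hp : Integrable fun x : Fin n → ℝ => ∏ i, (f (x i) : ℂ) :=
    Integrable.fintype_prod (f := fun _ x => (f x : ℂ)) fun _ => hf.ofReal
  refine tendsto_integral_filter_of_dominated_convergence (fun x => ‖∏ i, (f (x i) : ℂ)‖)
    (Eventually.of_forall fun N => hp.1.mul (continuous_gridDet N n).aestronglyMeasurable) ?_
    hp.norm (ae_of_all _ fun x => ?_)
  · filter_upwards [eventually_gt_atTop 0] with N hN
    refine ae_of_all _ fun x => ?_
    rw [norm_mul]
    exact mul_le_of_le_one_right (norm_nonneg _) (norm_gridDet_le hN x)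
  · push_cast
    exact (tendsto_gridDet x).const_mul _

end Fredholm

/-! ### A zero of the Fredholm determinant forces a negative correlation integral -/

section FredholmZero

open Filter Topology Matrix
open scoped ComplexOrder

/-- Tuples with a repetition contribute `0`, and each `n`-element set is enumerated by `n!`
injective tuples with the same minor. -/
lemma sum_det_submatrix {ι : Type*} [Fintype ι] [DecidableEq ι] (A : Matrix ι ι ℂ) (n : ℕ) :
    ∑ m : Fin n → ι, (A.submatrix m m).det = (n.factorial : ℂ) *
      ∑ s ∈ Finset.univ.powersetCard n,
        (A.submatrix (Subtype.val : ↥s → ι) (Subtype.val : ↥s → ι)).det := by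
  have h0 : ∀ m : Fin n → ι, ¬ Function.Injective m → (A.submatrix m m).det = 0 := by
    intro m hm
    obtain ⟨i, j, h, hne⟩ := Function.not_injective_iff.1 hm
    exact Matrix.det_zero_of_row_eq hne (by ext l; simp [h])
  have h1 : ∑ m : Fin n → ι, (A.submatrix m m).det =
      ∑ m : Fin n → ι with Function.Injective m, (A.submatrix m m).det := by
    rw [Finset.sum_filter]
    refine Finset.sum_congr rfl fun m _ => ?_
    split_ifs with h
    · rfl
    · exact h0 m h
  have hmaps : ∀ m ∈ (Finset.univ.filter fun m : Fin n → ι => Function.Injective m),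
      Finset.univ.image m ∈ Finset.univ.powersetCard n := by
    intro m hm
    rw [Finset.mem_powersetCard]
    exact ⟨Finset.subset_univ _, by
      rw [Finset.card_image_of_injective _ (Finset.mem_filter.1 hm).2]; simp⟩
  rw [h1, ← Finset.sum_fiberwise_of_maps_to hmaps, Finset.mul_sum]
  refine Finset.sum_congr rfl fun s hs => ?_
  have hs' : s.card = n := (Finset.mem_powersetCard.1 hs).2
  let E : (Fin n ≃ ↥s) ≃ {m : Fin n → ι // m ∈ (Finset.univ.filter fun m : Fin n → ι =>
      Function.Injective m).filter fun m => Finset.univ.image m = s} :=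
    { toFun := fun e => ⟨fun i => (e i).1, by
        simp only [Finset.mem_filter, Finset.mem_univ, true_and]
        refine ⟨Subtype.val_injective.comp e.injective, ?_⟩
        ext x
        simp only [Finset.mem_image, Finset.mem_univ, true_and]
        constructor
        · rintro ⟨i, rfl⟩; exact (e i).2
        · intro hx; exact ⟨e.symm ⟨x, hx⟩, by simp⟩⟩
      invFun := fun m => Equiv.ofBijective (fun i => ⟨m.1 i, by
          have := m.2
          simp only [Finset.mem_filter, Finset.mem_univ, true_and] at this
          exact (Finset.ext_iff.1 this.2 _).1 (Finset.mem_image_of_mem _ (Finset.mem_univ i))⟩) (by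
          have := m.2
          simp only [Finset.mem_filter, Finset.mem_univ, true_and] at this
          refine ⟨fun i j h => this.1 (congrArg Subtype.val h), ?_⟩
          rintro ⟨x, hx⟩
          rw [← this.2] at hx
          obtain ⟨i, -, rfl⟩ := Finset.mem_image.1 hx
          exact ⟨i, rfl⟩)
      left_inv := fun e => by ext i; rfl
      right_inv := fun m => by ext i; rfl }
  rw [← Finset.sum_coe_sort, ← E.sum_comp]
  have h2 : ∀ e : Fin n ≃ ↥s, (A.submatrix (E e).1 (E e).1).det =
      (A.submatrix (Subtype.val : ↥s → ι) (Subtype.val : ↥s → ι)).det := by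
    intro e
    rw [← Matrix.det_submatrix_equiv_self e]
    rfl
  simp_rw [h2]
  rw [Finset.sum_const, Finset.card_univ, Fintype.card_equiv (Fintype.equivOfCardEq (by simp [hs'])),
    Fintype.card_fin, nsmul_eq_mul]

lemma hasSum_det_one_add_smul {ι : Type*} [Fintype ι] [DecidableEq ι] (A : Matrix ι ι ℂ) (t : ℂ) :
    HasSum (fun n : ℕ => t ^ n / n.factorial * ∑ m : Fin n → ι, (A.submatrix m m).det)
      (1 + t • A).det := by
  let p : Polynomial ℂ := (1 + (Polynomial.X : Polynomial ℂ) • A.map Polynomial.C).det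
  have hcoeff : ∀ n, p.coeff n = ∑ s ∈ Finset.univ.powersetCard n,
        (A.submatrix (Subtype.val : ↥s → ι) (Subtype.val : ↥s → ι)).det :=
    Matrix.coeff_det_one_add_X_smul_eq_sum_minors A
  have hterm : ∀ n : ℕ, t ^ n / n.factorial * ∑ m : Fin n → ι, (A.submatrix m m).det =
      p.coeff n * t ^ n := by
    intro n
    have : (n.factorial : ℂ) ≠ 0 := by exact_mod_cast n.factorial_ne_zero
    rw [sum_det_submatrix, hcoeff]
    field_simp
  have heval : (1 + t • A).det = p.eval t := by
    rw [← Polynomial.coe_evalRingHom, RingHom.map_det]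
    congr 1
    ext i j
    simp [Matrix.one_apply, apply_ite]
    exact mul_comm _ _
  simp_rw [hterm]
  rw [heval, Polynomial.eval_eq_sum_range]
  refine hasSum_sum_of_ne_finset_zero fun n hn => ?_
  rw [Polynomial.coeff_eq_zero_of_natDegree_lt, zero_mul]
  simpa using hn

lemma isHermitian_gridMatrix (N : ℕ) (f : ℝ → ℝ) : (gridMatrix N f).IsHermitian := by
  ext p q
  simp only [Matrix.conjTranspose_apply, gridMatrix, Matrix.of_apply, RCLike.star_def, map_mul,
    map_inv₀, map_natCast]
  congr 1
  rw [← integral_conj]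
  refine integral_congr_ae (ae_of_all _ fun x => ?_)
  simp only [map_mul, Complex.conj_ofReal, conj_wave, wave_neg_left, neg_sub]

/-- A Hermitian matrix whose quadratic form takes a value below `-l` times the squared norm makes
`1 + τ A` singular for some `0 < τ ≤ 1 / l`. -/
lemma exists_det_eq_zero {ι : Type*} [Fintype ι] [DecidableEq ι] {A : Matrix ι ι ℂ}
    (hA : A.IsHermitian) {l : ℝ} (hl : 0 < l) {w : ι → ℂ}
    (hw : (star w ⬝ᵥ (A *ᵥ w)).re + l * ∑ i, ‖w i‖ ^ 2 < 0) :
    ∃ τ : ℝ, 0 < τ ∧ τ ≤ 1 / l ∧ (1 + (τ : ℂ) • A).det = 0 := by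
  -- The shifted matrix has an eigenvalue `μ < 0`, so `A` has the eigenvalue `μ - l < -l`, and `τ =
  -- 1/(l - μ)` makes `1 + τ A` singular.
  set M : Matrix ι ι ℂ := A + (l : ℂ) • 1 with hM
  have hMh : M.IsHermitian := by
    refine hA.add ?_
    rw [Matrix.IsHermitian, Matrix.conjTranspose_smul, Matrix.conjTranspose_one]
    simp
  have hnot : ¬ M.PosSemidef := by
    intro h
    have h1 := (Complex.le_def.1 (h.dotProduct_mulVec_nonneg w)).1
    have h2 : (star w ⬝ᵥ (M *ᵥ w)).re = (star w ⬝ᵥ (A *ᵥ w)).re + l * ∑ i, ‖w i‖ ^ 2 := by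
      rw [hM, Matrix.add_mulVec, dotProduct_add, Complex.add_re, Matrix.smul_mulVec,
        Matrix.one_mulVec, dotProduct_smul, smul_eq_mul, Complex.re_ofReal_mul]
      congr 2
      rw [dotProduct, Complex.re_sum]
      refine Finset.sum_congr rfl fun i _ => ?_
      rw [Pi.star_apply, RCLike.star_def, ← Complex.normSq_eq_conj_mul_self, Complex.ofReal_re,
        Complex.normSq_eq_norm_sq]
    rw [h2] at h1
    simp at h1
    linarith
  rw [hMh.posSemidef_iff_eigenvalues_nonneg, Pi.le_def, not_forall] at hnot
  obtain ⟨i, hi⟩ := hnot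
  rw [Pi.zero_apply, not_le] at hi
  set μ := hMh.eigenvalues i with hμ
  let v : ι → ℂ := hMh.eigenvectorBasis i
  have hv : M *ᵥ v = (μ : ℂ) • v := hMh.mulVec_eigenvectorBasis i
  have hv0 : v ≠ 0 := by
    intro h
    exact hMh.eigenvectorBasis.orthonormal.ne_zero i (by ext j; exact congrFun h j)
  have hpos : 0 < l - μ := by linarith
  refine ⟨1 / (l - μ), by positivity, one_div_le_one_div_of_le hl (by linarith), ?_⟩
  rw [← Matrix.exists_mulVec_eq_zero_iff]
  refine ⟨v, hv0, ?_⟩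
  have hAv : A *ᵥ v = ((μ : ℂ) - l) • v := by
    rw [hM, Matrix.add_mulVec, Matrix.smul_mulVec, Matrix.one_mulVec] at hv
    rw [sub_smul, ← hv, add_sub_cancel_right]
  rw [Matrix.add_mulVec, Matrix.one_mulVec, Matrix.smul_mulVec, hAv, smul_smul]
  have : ((1 / (l - μ) : ℝ) : ℂ) * ((μ : ℂ) - l) = -1 := by
    have h : ((l : ℂ) - μ) ≠ 0 := by exact_mod_cast hpos.ne'
    push_cast
    field_simp
    ring
  rw [this, neg_one_smul, add_neg_cancel]

/-- The quadratic form of the grid matrix is an integral of `f` against the squared modulus of a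
trigonometric polynomial. -/
lemma quadForm_gridMatrix (N : ℕ) {f : ℝ → ℝ} (hf : Integrable f) (g : ℝ → ℂ) :
    (N : ℂ)⁻¹ * (star (fun p => star (g (gridPt N p))) ⬝ᵥ
      (gridMatrix N f *ᵥ fun p => star (g (gridPt N p)))) =
      ((∫ x, f x * ‖gridMean N fun t => g t * wave x t‖ ^ 2 : ℝ) : ℂ) := by
  rw [← integral_complex_ofReal]
  have hx : ∀ x : ℝ, ((f x * ‖gridMean N fun t => g t * wave x t‖ ^ 2 : ℝ) : ℂ) =
      ∑ p : Fin N, ∑ q : Fin N, ((N : ℂ)⁻¹ * (N : ℂ)⁻¹ * (g (gridPt N p) * star (g (gridPt N q)))) *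
        ((f x : ℂ) * wave x (gridPt N p - gridPt N q)) := by
    intro x
    rw [Complex.ofReal_mul, Complex.ofReal_pow, ← Complex.mul_conj', gridMean, map_mul, map_sum,
      map_inv₀, map_natCast, mul_mul_mul_comm, Finset.sum_mul_sum, Finset.mul_sum, Finset.mul_sum]
    refine Finset.sum_congr rfl fun p _ => ?_
    rw [Finset.mul_sum, Finset.mul_sum]
    refine Finset.sum_congr rfl fun q _ => ?_
    rw [map_mul, conj_wave, wave_neg_left, sub_eq_add_neg, wave_add_right, RCLike.star_def]
    ring
  simp_rw [hx]
  rw [integral_finsetSum _ fun p _ => integrable_finsetSum _ fun q _ =>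
    (integrable_mul_wave hf _).const_mul _]
  rw [dotProduct, Finset.mul_sum]
  refine Finset.sum_congr rfl fun p _ => ?_
  rw [integral_finsetSum _ fun q _ => (integrable_mul_wave hf _).const_mul _]
  rw [Matrix.mulVec, dotProduct, Finset.mul_sum, Finset.mul_sum]
  refine Finset.sum_congr rfl fun q _ => ?_
  rw [integral_const_mul]
  simp only [gridMatrix, Matrix.of_apply, Pi.star_apply, star_star]
  ring

/-- If multiplication by an integrable function `f` is not a positive operator on the functions with
frequencies in `[-1/2, 1/2]`, then its integrals against the correlation functions of the
sine process are not all nonnegative. -/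
theorem exists_integral_sineDet_neg {f : ℝ → ℝ} (hf : Integrable f) {g : ℝ → ℂ} (hg : Continuous g)
    (hneg : ∫ x, f x * ‖∫ t in (-(1 / 2) : ℝ)..(1 / 2), g t * wave x t‖ ^ 2 < 0) :
    ∃ n : ℕ, 1 ≤ n ∧ ∫ x : Fin n → ℝ, (∏ i, f (x i)) * sineDet (WithLp.toLp 2 x) < 0 := by
  by_contra! hcon
  set I := ∫ x, f x * ‖∫ t in (-(1 / 2) : ℝ)..(1 / 2), g t * wave x t‖ ^ 2 with hI
  have hwc : ∀ x, Continuous fun t => g t * wave x t := by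
    intro x
    have := continuous_wave
    fun_prop
  obtain ⟨C, hC⟩ := (isCompact_Icc (a := (-(1 / 2) : ℝ)) (b := 1 / 2)).exists_bound_of_continuousOn
    hg.continuousOn
  have hgrid : ∀ N (p : Fin N), gridPt N p ∈ Set.Icc (-(1 / 2) : ℝ) (1 / 2) := by
    intro N p
    have hN : (0 : ℝ) < N := by exact_mod_cast p.pos
    have h1 : (p : ℝ) / N ≤ 1 := (div_le_one hN).2 (by exact_mod_cast p.2.le)
    have h2 : (0 : ℝ) ≤ p / N := by positivity
    constructor <;> unfold gridPt <;> linarith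
  have hC0 : 0 ≤ C := (norm_nonneg _).trans (hC 0 (by norm_num))
  have hmean : ∀ N x, ‖gridMean N fun t => g t * wave x t‖ ≤ C := by
    intro N x
    rw [gridMean, norm_mul, norm_inv, Complex.norm_natCast]
    rcases Nat.eq_zero_or_pos N with rfl | hN
    · simpa using hC0
    · rw [inv_mul_le_iff₀ (by exact_mod_cast hN)]
      refine (norm_sum_le_of_le _ fun p _ => ?_ : _ ≤ ∑ _p : Fin N, C).trans (by simp)
      rw [norm_mul, norm_wave, mul_one]
      exact hC _ (hgrid N p)
  have hlim : Tendsto (fun N => ∫ x, f x * ‖gridMean N fun t => g t * wave x t‖ ^ 2) atTop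
      (𝓝 I) := by
    refine tendsto_integral_of_dominated_convergence (fun x => |f x| * C ^ 2) (fun N => ?_)
      (hf.abs.mul_const _) (fun N => ae_of_all _ fun x => ?_) (ae_of_all _ fun x => ?_)
    · refine hf.1.mul (Continuous.aestronglyMeasurable ?_)
      have := continuous_wave
      unfold gridMean
      fun_prop
    · rw [norm_mul, Real.norm_eq_abs, norm_pow, norm_norm]
      gcongr
      exact hmean N x
    · exact ((tendsto_gridMean (hwc x)).norm.pow 2).const_mul _
  -- Chosen so that `I + l C² < 0`. For large `N` the grid matrices then have an eigenvalue below
  -- `-l`, and the zero `τ` stays in the fixed interval `(0, 1/l]`.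
  let l : ℝ := -I / (2 * (C ^ 2 + 1))
  have hl : 0 < l := div_pos (neg_pos.2 hneg) (by positivity)
  have hlC : I + l * C ^ 2 < 0 := by
    have h1 : l * (2 * (C ^ 2 + 1)) = -I := div_mul_cancel₀ _ (by positivity)
    nlinarith [sq_nonneg C]
  have hzero : ∀ᶠ N : ℕ in atTop, ∃ τ : ℝ, 0 < τ ∧ τ ≤ 1 / l ∧
      (1 + (τ : ℂ) • gridMatrix N f).det = 0 := by
    have h1 : ∀ᶠ N : ℕ in atTop,
        (∫ x, f x * ‖gridMean N fun t => g t * wave x t‖ ^ 2) + l * C ^ 2 < 0 :=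
      (hlim.add_const _).eventually_lt_const hlC
    filter_upwards [h1, eventually_gt_atTop 0] with N hN hN0
    refine exists_det_eq_zero (isHermitian_gridMatrix N f) hl
      (w := fun p => star (g (gridPt N p))) ?_
    have hNr : (0 : ℝ) < N := by exact_mod_cast hN0
    have h2 := congrArg Complex.re (quadForm_gridMatrix N hf g)
    rw [Complex.ofReal_re, show ((N : ℂ)⁻¹) = (((N : ℝ)⁻¹ : ℝ) : ℂ) by push_cast; rfl,
      Complex.re_ofReal_mul, inv_mul_eq_iff_eq_mul₀ hNr.ne'] at h2
    rw [h2]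
    have h3 : ∑ p : Fin N, ‖star (g (gridPt N p))‖ ^ 2 ≤ N * C ^ 2 := by
      refine (Finset.sum_le_sum (g := fun _ => C ^ 2) fun p _ => ?_).trans (by simp)
      rw [norm_star]
      gcongr
      exact hC _ (hgrid N p)
    nlinarith [mul_le_mul_of_nonneg_left h3 hl.le, mul_neg_of_pos_of_neg hNr hN]
  let T : ℝ := 1 / l
  have hT : 0 < T := by positivity
  let M : ℝ := ∫ x, |f x|
  have hM : 0 ≤ M := integral_nonneg fun x => abs_nonneg _
  -- The negative parts of the coefficients, weighted with the largest admissible `τ`. Their sum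
  -- tends to `0`, since the limiting coefficients are assumed nonnegative and `(T M)^n / n!`
  -- dominates.
  let δ : ℕ → ℕ → ℝ := fun N n => T ^ n / n.factorial * max 0 (-(gridCorr N n f).re)
  have hδ : Tendsto (fun N => ∑' n, δ N n) atTop (𝓝 (∑' _n : ℕ, (0 : ℝ))) := by
    refine tendsto_tsum_of_dominated_convergence (Real.summable_pow_div_factorial (T * M))
      (fun n => ?_) ?_
    · have h1 : Tendsto (fun N => (gridCorr N n f).re) atTop
          (𝓝 (∫ x : Fin n → ℝ, (∏ i, f (x i)) * sineDet (WithLp.toLp 2 x))) := by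
        have := (Complex.continuous_re.tendsto _).comp (tendsto_gridCorr n hf)
        rwa [Complex.ofReal_re] at this
      have h2 : 0 ≤ ∫ x : Fin n → ℝ, (∏ i, f (x i)) * sineDet (WithLp.toLp 2 x) := by
        rcases Nat.eq_zero_or_pos n with rfl | hn
        · refine integral_nonneg fun x => ?_
          simp [sineDet]
        · exact hcon n hn
      have h3 := ((tendsto_const_nhds (x := (0 : ℝ))).max h1.neg).const_mul (T ^ n / n.factorial)
      rwa [max_eq_left (by linarith), mul_zero] at h3
    · filter_upwards [eventually_gt_atTop 0] with N hN n
      have h1 : max 0 (-(gridCorr N n f).re) ≤ M ^ n :=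
        max_le (by positivity) ((neg_le_abs _).trans
          ((Complex.abs_re_le_norm _).trans (norm_gridCorr_le hN n f hf)))
      rw [Real.norm_of_nonneg (by positivity), mul_pow, mul_div_right_comm]
      exact mul_le_mul_of_nonneg_left h1 (by positivity)
  rw [tsum_zero] at hδ
  have hδ1 := hδ.eventually_lt_const (zero_lt_one (α := ℝ))
  obtain ⟨N, ⟨τ, hτ0, hτ1, hdet⟩, hδN, hN⟩ :=
    (hzero.and (hδ1.and (eventually_gt_atTop 0))).exists
  have hs := hasSum_det_one_add_smul (gridMatrix N f) (τ : ℂ)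
  rw [hdet] at hs
  simp_rw [← gridCorr_eq_sum N _ hf] at hs
  have hs' := Complex.hasSum_re hs
  have hre : ∀ n : ℕ, ((τ : ℂ) ^ n / n.factorial * gridCorr N n f).re =
      τ ^ n / n.factorial * (gridCorr N n f).re := by
    intro n
    rw [show (τ : ℂ) ^ n / n.factorial = ((τ ^ n / n.factorial : ℝ) : ℂ) by push_cast; rfl,
      Complex.re_ofReal_mul]
  simp_rw [hre, Complex.zero_re] at hs'
  have hδs : Summable (δ N) := by
    refine (Real.summable_pow_div_factorial (T * M)).of_nonneg_of_le
      (fun n => by positivity) fun n => ?_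
    have h1 : max 0 (-(gridCorr N n f).re) ≤ M ^ n :=
      max_le (by positivity) ((neg_le_abs _).trans
        ((Complex.abs_re_le_norm _).trans (norm_gridCorr_le hN n f hf)))
    rw [mul_pow, mul_div_right_comm]
    exact mul_le_mul_of_nonneg_left h1 (by positivity)
  -- The constant term is `1`, so the series is at least `1 - ∑ δ N n > 0`, although it sums to the
  -- vanishing determinant.
  have hle : ∀ n, (if n = 0 then (1 : ℝ) else 0) - δ N n ≤
      τ ^ n / n.factorial * (gridCorr N n f).re := by
    intro n
    rcases Nat.eq_zero_or_pos n with rfl | hn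
    · have : gridCorr N 0 f = 1 := by rw [gridCorr_eq_sum N 0 hf]; simp
      simp [δ, this]
    · rw [if_neg hn.ne', zero_sub]
      have h1 : τ ^ n / n.factorial * max 0 (-(gridCorr N n f).re) ≤ δ N n := by
        simp only [δ]
        gcongr
      have h2 : τ ^ n / n.factorial * (-(gridCorr N n f).re) ≤
          τ ^ n / n.factorial * max 0 (-(gridCorr N n f).re) := by
        gcongr
        exact le_max_right _ _
      linarith
  have := hasSum_le hle ((hasSum_ite_eq 0 (1 : ℝ)).sub hδs.hasSum) hs'
  linarith

end FredholmZero

/-! ### Bumps, Dirichlet kernels and trigonometric polynomials -/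

section TestFunction

open Filter Topology
open scoped ContDiff Convolution

lemma fourier_eq_wave (f : ℝ → ℂ) (x : ℝ) : 𝓕 f x = ∫ s, wave x (-s) * f s := by
  rw [Real.fourier_real_eq_integral_exp_smul]
  refine integral_congr_ae (ae_of_all _ fun s => ?_)
  simp only [wave, smul_eq_mul]
  congr 3
  ring_nf

lemma integral_fourier_mul_wave (r : SchwartzMap ℝ ℂ) (s : ℝ) :
    ∫ x, 𝓕 r x * wave x s = r s := by
  have h1 : 𝓕⁻ (𝓕 r) = r := FourierTransform.fourierInv_fourier_eq r
  conv_rhs => rw [← h1]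
  rw [SchwartzMap.fourierInv_coe, Real.fourierInv_eq']
  refine integral_congr_ae (ae_of_all _ fun x => ?_)
  simp only [wave, smul_eq_mul]
  rw [mul_comm]
  congr 4
  simp only [RCLike.inner_apply, conj_trivial]
  ring

lemma exists_even_bump {δ : ℝ} (hδ : 0 < δ) : ∃ b : SchwartzMap ℝ ℂ, (∀ s, b s ≠ 0 → |s| < δ) ∧
    (∀ s, b (-s) = b s) ∧ (∀ s, (starRingEnd ℂ) (b s) = b s) ∧ b 0 ≠ 0 := by
  let β : ContDiffBump (0 : ℝ) := ⟨δ / 2, δ, by positivity, by linarith⟩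
  have h1 : HasCompactSupport fun s => (β s : ℂ) :=
    β.hasCompactSupport.comp_left (g := fun x : ℝ => (x : ℂ)) rfl
  have h2 : ContDiff ℝ ∞ fun s => (β s : ℂ) := Complex.ofRealCLM.contDiff.comp β.contDiff
  refine ⟨h1.toSchwartzMap h2, fun s hs => ?_, fun s => ?_, fun s => ?_, ?_⟩
  · have h3 : β s ≠ 0 := fun h => hs (by change (β s : ℂ) = 0; rw [h, Complex.ofReal_zero])
    have : s ∈ Function.support β := h3
    rw [β.support_eq] at this
    simpa using this
  · change (β (-s) : ℂ) = β s
    rw [β.neg]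
  · exact Complex.conj_ofReal _
  · change (β 0 : ℂ) ≠ 0
    rw [β.one_of_mem_closedBall (by simp [β.rIn_pos.le])]
    simp

/-- The convolution of a Schwartz function with itself. -/
def selfConv (p : SchwartzMap ℝ ℂ) : SchwartzMap ℝ ℂ :=
  SchwartzMap.convolution (ContinuousLinearMap.mul ℂ ℂ) p p

/-- For an even real bump the transform is real, so this square is a nonnegative damping factor with
compact spectrum. -/
lemma fourier_selfConv (p : SchwartzMap ℝ ℂ) (x : ℝ) : 𝓕 (selfConv p) x = (𝓕 p x) ^ 2 := by
  rw [selfConv, SchwartzMap.fourier_convolution, sq]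
  rfl

lemma selfConv_support {p : SchwartzMap ℝ ℂ} {δ : ℝ} (hp : ∀ s, p s ≠ 0 → |s| < δ) (s : ℝ)
    (hs : selfConv p s ≠ 0) : |s| < 2 * δ := by
  rw [selfConv, SchwartzMap.convolution_apply] at hs
  obtain ⟨s₁, h₁, s₂, h₂, rfl⟩ := support_convolution_subset (ContinuousLinearMap.mul ℂ ℂ) hs
  have := abs_add_le s₁ s₂
  change |s₁ + s₂| < _
  linarith [hp _ h₁, hp _ h₂]

lemma conj_fourier_of_even {b : SchwartzMap ℝ ℂ} (h1 : ∀ s, b (-s) = b s)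
    (h2 : ∀ s, (starRingEnd ℂ) (b s) = b s) (x : ℝ) : (starRingEnd ℂ) (𝓕 b x) = 𝓕 b x := by
  rw [SchwartzMap.fourier_coe, fourier_eq_wave, ← integral_conj, ← integral_neg_eq_self]
  refine integral_congr_ae (ae_of_all _ fun s => ?_)
  simp only [map_mul, conj_wave, wave_neg_left, h1, h2, neg_neg]

/-- The Dirichlet kernel with frequencies `-M t, …, M t`. -/
def dirichlet (M : ℕ) (t x : ℝ) : ℂ :=
  ∑ i ∈ Finset.range (2 * M + 1), wave x (((i : ℝ) - M) * t)

lemma conj_dirichlet (M : ℕ) (t x : ℝ) : (starRingEnd ℂ) (dirichlet M t x) = dirichlet M t x := by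
  rw [dirichlet, map_sum, ← Finset.sum_range_reflect]
  refine Finset.sum_congr rfl fun i hi => ?_
  rw [conj_wave, wave_neg_left]
  congr 1
  have : i ≤ 2 * M := by rw [Finset.mem_range] at hi; omega
  rw [show 2 * M + 1 - 1 - i = 2 * M - i by omega, Nat.cast_sub this]
  push_cast
  ring

lemma ofReal_re_dirichlet (M : ℕ) (t x : ℝ) : (((dirichlet M t x).re : ℝ) : ℂ) = dirichlet M t x :=
  Complex.conj_eq_iff_re.1 (conj_dirichlet M t x)

lemma wave_zero (x : ℝ) : wave x 0 = 1 := by simp [wave]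

/-- At lattice points the wave `ζ` is a `(2M+1)`-th root of unity: the geometric sum is `2M+1` if `ζ
= 1` and `0` otherwise. -/
lemma dirichlet_lattice_nonneg {M : ℕ} {t a : ℝ} (h : a * t * (2 * M + 1) = 1) (k : ℤ) :
    0 ≤ (dirichlet M t (a * k)).re := by
  set ζ : ℂ := wave (a * k) t with hζ
  have hpow : ∀ i : ℕ, wave (a * k) (i * t) = ζ ^ i := by
    intro i
    rw [hζ, wave, wave, ← Complex.exp_nat_mul]
    congr 1
    push_cast
    ring
  have hone : ζ ^ (2 * M + 1) = 1 := by
    rw [← hpow, wave, Complex.exp_eq_one_iff]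
    refine ⟨k, ?_⟩
    have : 2 * Real.pi * (a * k) * (((2 * M + 1 : ℕ) : ℝ) * t) = 2 * Real.pi * k := by
      push_cast
      linear_combination (2 * Real.pi * k) * h
    rw [this]
    push_cast
    ring
  have hD : dirichlet M t (a * k) = wave (a * k) (-(M * t)) *
      ∑ i ∈ Finset.range (2 * M + 1), ζ ^ i := by
    rw [dirichlet, Finset.mul_sum]
    refine Finset.sum_congr rfl fun i _ => ?_
    rw [← hpow, ← wave_add_right]
    congr 1
    ring
  rcases eq_or_ne ζ 1 with h1 | h1
  · have h2 : wave (a * k) (-(M * t)) = 1 := by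
      have h3 : wave (a * k) (M * t) * wave (a * k) (-(M * t)) = 1 := by
        rw [← wave_add_right, add_neg_cancel, wave_zero]
      rwa [hpow, h1, one_pow, one_mul] at h3
    have h4 : dirichlet M t (a * k) = ((2 * M + 1 : ℕ) : ℂ) := by
      rw [hD, h2, h1]
      simp
    rw [h4, Complex.natCast_re]
    positivity
  · have : ∑ i ∈ Finset.range (2 * M + 1), ζ ^ i = 0 := by
      have h2 := mul_geom_sum ζ (2 * M + 1)
      rw [hone, sub_self] at h2
      exact (mul_eq_zero.1 h2).resolve_left (sub_ne_zero.2 h1)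
    rw [hD, this, mul_zero, Complex.zero_re]

lemma fourier_sum_translate (p : SchwartzMap ℝ ℂ) (M : ℕ) (t x : ℝ) :
    𝓕 (fun s => ∑ i ∈ Finset.range (2 * M + 1), p (s + ((i : ℝ) - M) * t)) x =
      dirichlet M t x * 𝓕 p x := by
  have hwave := continuous_wave
  have hi : ∀ c : ℝ, Integrable fun s => wave x (-s) * p (s + c) := by
    intro c
    refine (p.integrable.comp_add_right c).bdd_mul (c := 1) (by fun_prop)
      (ae_of_all _ fun s => (norm_wave _ _).le)
  rw [fourier_eq_wave]
  simp_rw [Finset.mul_sum]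
  rw [integral_finsetSum _ fun i _ => hi _, dirichlet, Finset.sum_mul]
  refine Finset.sum_congr rfl fun i _ => ?_
  rw [SchwartzMap.fourier_coe, fourier_eq_wave, ← integral_const_mul,
    ← integral_add_right_eq_self (fun s => wave x (((i : ℝ) - M) * t) * (wave x (-s) * p s))
      (((i : ℝ) - M) * t)]
  refine integral_congr_ae (ae_of_all _ fun s => ?_)
  simp only
  rw [← mul_assoc, ← wave_add_right]
  congr 2
  ring

lemma integral_translates_mul_wave (b : SchwartzMap ℝ ℂ) (c x : ℝ) :
    ∫ s, b (s - c) * wave x s = wave x c * (∫ s, b s * wave x s) := by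
  rw [← integral_const_mul, ← integral_sub_right_eq_self
    (fun s => wave x c * (b s * wave x s)) c]
  refine integral_congr_ae (ae_of_all _ fun s => ?_)
  simp only
  rw [mul_left_comm, ← wave_add_right]
  congr 2
  ring

/-- The trigonometric polynomial `1 - e(tx) + e((M+1)tx)`. -/
def trigPoly (M : ℕ) (t x : ℝ) : ℂ := 1 - wave x t + wave x ((M + 1) * t)

lemma trigPoly_mul_conj (M : ℕ) (t x : ℝ) :
    trigPoly M t x * (starRingEnd ℂ) (trigPoly M t x) =
      3 * wave x (((0 : ℤ) : ℝ) * t) - wave x (((1 : ℤ) : ℝ) * t) - wave x (((-1 : ℤ) : ℝ) * t)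
      + wave x (((M + 1 : ℤ) : ℝ) * t) + wave x (((-(M + 1) : ℤ) : ℝ) * t)
      - wave x (((M : ℤ) : ℝ) * t) - wave x (((-M : ℤ) : ℝ) * t) := by
  have h1 : wave x t * wave x (-t) = 1 := by rw [← wave_add_right, add_neg_cancel, wave_zero]
  have h2 : wave x ((M + 1) * t) * wave x (-((M + 1) * t)) = 1 := by
    rw [← wave_add_right, add_neg_cancel, wave_zero]
  have h3 : wave x ((M + 1) * t) * wave x (-t) = wave x (((M : ℤ) : ℝ) * t) := by
    rw [← wave_add_right]; congr 1; push_cast; ring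
  have h4 : wave x t * wave x (-((M + 1) * t)) = wave x (((-M : ℤ) : ℝ) * t) := by
    rw [← wave_add_right]; congr 1; push_cast; ring
  simp only [trigPoly, map_add, map_sub, map_one, conj_wave, wave_neg_left]
  rw [← h3, ← h4]
  push_cast
  rw [zero_mul, wave_zero, one_mul, neg_one_mul, show (-((M : ℝ) + 1)) * t = -((M + 1) * t) by ring]
  linear_combination h1 + h2

/-- The integral of the fourth power of `𝓕 b` against the Dirichlet kernel times a wave of frequency
`k t` picks out whether `|k| ≤ M`. -/
lemma integral_dirichlet_mul_wave {r : SchwartzMap ℝ ℂ} {t : ℝ} (ht : 0 < t)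
    (hr : ∀ s, r s ≠ 0 → |s| < t) (M : ℕ) (k : ℤ) :
    Integrable (fun x => 𝓕 r x * dirichlet M t x * wave x (k * t)) ∧
    ∫ x, 𝓕 r x * dirichlet M t x * wave x (k * t) = if |k| ≤ M then r 0 else 0 := by
  have hwave := continuous_wave
  have hi : ∀ c : ℝ, Integrable fun x => 𝓕 r x * wave x c := fun c =>
    (𝓕 r).integrable.mul_bdd (c := 1) (by fun_prop) (ae_of_all _ fun s => (norm_wave _ _).le)
  have hexp : ∀ x, 𝓕 r x * dirichlet M t x * wave x (k * t) =
      ∑ i ∈ Finset.range (2 * M + 1), 𝓕 r x * wave x ((((i : ℤ) - M + k : ℤ) : ℝ) * t) := by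
    intro x
    rw [dirichlet, mul_assoc, Finset.sum_mul, Finset.mul_sum]
    refine Finset.sum_congr rfl fun i _ => ?_
    rw [← wave_add_right]
    congr 2
    push_cast
    ring
  simp_rw [hexp]
  refine ⟨integrable_finsetSum _ fun i _ => hi _, ?_⟩
  rw [integral_finsetSum _ fun i _ => hi _]
  -- By Fourier inversion the integral is `r (j t)`, and `r` is supported in `|s| < t`.
  have hval : ∀ j : ℤ, ∫ x, 𝓕 r x * wave x ((j : ℝ) * t) = if j = 0 then r 0 else 0 := by
    intro j
    rw [integral_fourier_mul_wave]
    split_ifs with h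
    · simp [h]
    · by_contra hne
      have h1 := hr _ hne
      rw [abs_mul, abs_of_pos ht] at h1
      have h2 : (1 : ℝ) ≤ |(j : ℝ)| := by exact_mod_cast Int.one_le_abs h
      nlinarith
  simp_rw [hval]
  split_ifs with hk
  · rw [abs_le] at hk
    rw [Finset.sum_eq_single (M - k).toNat]
    · rw [if_pos]; omega
    · intro i _ hi
      rw [if_neg]; omega
    · intro h
      rw [Finset.mem_range] at h
      omega
  · refine Finset.sum_eq_zero fun i hi => ?_
    rw [Finset.mem_range] at hi
    rw [if_neg]
    intro h
    apply hk
    rw [abs_le]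
    omega

end TestFunction

/-! ### A band-limited function nonnegative on the lattice but not as an operator -/

section Obstruction

open Filter Topology
open scoped ContDiff

/-- With `t = 2B/(2M+1)`, the span `(M+1)t` tends to `B < 1` as `M` grows. The relation `Mt + t/2 =
B` leaves room `t/2` for widening the Dirichlet frequencies inside the band. -/
lemma exists_dirichlet_parameters {B : ℝ} (hB : 0 < B) (hB1 : B < 1) :
    ∃ (M : ℕ) (t : ℝ), 1 ≤ M ∧ 0 < t ∧ (M + 1) * t < 1 ∧ t * (2 * M + 1) = 2 * B := by
  obtain ⟨M, hM⟩ := exists_nat_gt (1 / (1 - B))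
  have hB2 : 0 < 1 - B := by linarith
  have hM0 : (0 : ℝ) < M := lt_trans (by positivity) hM
  rw [div_lt_iff₀ hB2] at hM
  refine ⟨M, 2 * B / (2 * M + 1), by exact_mod_cast hM0, by positivity, ?_, ?_⟩
  · rw [← mul_div_assoc, div_lt_one (by positivity)]
    nlinarith
  · field_simp

/-- Of the frequencies in `|trigPoly|²`, only those with `|k| ≤ M` count: `3` from `0`, `-2` from
`±1`, `-2` from `±M`, and nothing from the positive terms at `±(M+1)`. -/
lemma integral_dirichlet_mul_trigPoly {r : SchwartzMap ℝ ℂ} {t : ℝ} (ht : 0 < t)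
    (hr : ∀ s, r s ≠ 0 → |s| < t) {M : ℕ} (hM : 1 ≤ M) :
    ∫ x, 𝓕 r x * dirichlet M t x * (trigPoly M t x * (starRingEnd ℂ) (trigPoly M t x)) =
      - r 0 := by
  have hi := fun k => (integral_dirichlet_mul_wave ht hr M k).1
  have hv := fun k => (integral_dirichlet_mul_wave ht hr M k).2
  have hexp : ∀ x, 𝓕 r x * dirichlet M t x * (trigPoly M t x * (starRingEnd ℂ) (trigPoly M t x)) =
      3 * (𝓕 r x * dirichlet M t x * wave x (((0 : ℤ) : ℝ) * t))
      - 𝓕 r x * dirichlet M t x * wave x (((1 : ℤ) : ℝ) * t)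
      - 𝓕 r x * dirichlet M t x * wave x (((-1 : ℤ) : ℝ) * t)
      + 𝓕 r x * dirichlet M t x * wave x (((M + 1 : ℤ) : ℝ) * t)
      + 𝓕 r x * dirichlet M t x * wave x (((-(M + 1) : ℤ) : ℝ) * t)
      - 𝓕 r x * dirichlet M t x * wave x (((M : ℤ) : ℝ) * t)
      - 𝓕 r x * dirichlet M t x * wave x (((-M : ℤ) : ℝ) * t) := by
    intro x
    rw [trigPoly_mul_conj]
    ring
  simp_rw [hexp]
  rw [integral_sub, integral_sub, integral_add, integral_add, integral_sub, integral_sub,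
    integral_const_mul, hv, hv, hv, hv, hv, hv, hv]
  · have hM' : (1 : ℤ) ≤ M := by exact_mod_cast hM
    have e1 : |(M + 1 : ℤ)| = M + 1 := abs_of_nonneg (by positivity)
    have e2 : |(M : ℤ)| = M := abs_of_nonneg (by positivity)
    rw [abs_zero, abs_neg, abs_neg, abs_neg, abs_one, e1, e2, if_pos (by positivity), if_pos hM',
      if_neg (by omega), if_pos le_rfl]
    ring
  · exact (hi 0).const_mul 3
  · exact hi 1
  · exact ((hi 0).const_mul 3).sub (hi 1)
  · exact hi (-1)
  · exact (((hi 0).const_mul 3).sub (hi 1)).sub (hi (-1))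
  · exact hi (M + 1)
  · exact ((((hi 0).const_mul 3).sub (hi 1)).sub (hi (-1))).add (hi (M + 1))
  · exact hi (-(M + 1))
  · exact (((((hi 0).const_mul 3).sub (hi 1)).sub (hi (-1))).add (hi (M + 1))).add (hi (-(M + 1)))
  · exact hi M
  · exact ((((((hi 0).const_mul 3).sub (hi 1)).sub (hi (-1))).add (hi (M + 1))).add
      (hi (-(M + 1)))).sub (hi M)
  · exact hi (-M)

lemma integral_mul_wave_of_even {b : SchwartzMap ℝ ℂ} (h1 : ∀ s, b (-s) = b s) (x : ℝ) :
    ∫ s, b s * wave x s = 𝓕 b x := by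
  rw [SchwartzMap.fourier_coe, fourier_eq_wave, ← integral_neg_eq_self]
  refine integral_congr_ae (ae_of_all _ fun s => ?_)
  simp only [h1, mul_comm]

lemma setIntegral_eq_integral_mul_wave {g : ℝ → ℂ} (hg : ∀ s, g s ≠ 0 → |s| < 1 / 2) (x : ℝ) :
    ∫ s in (-(1 / 2) : ℝ)..(1 / 2), g s * wave x s = ∫ s, g s * wave x s := by
  rw [intervalIntegral.integral_of_le (by norm_num)]
  refine setIntegral_eq_integral_of_forall_compl_eq_zero fun s hs => ?_
  by_contra hne
  have := abs_lt.1 (hg s (left_ne_zero_of_mul hne))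
  exact hs ⟨this.1, this.2.le⟩

lemma integral_three_translates (b : SchwartzMap ℝ ℂ) (M : ℕ) (c t x : ℝ) :
    ∫ s, (b (s - c) - b (s - (c + t)) + b (s - (c + (M + 1) * t))) * wave x s =
      wave x c * trigPoly M t x * ∫ s, b s * wave x s := by
  have hwave := continuous_wave
  have hi : ∀ c : ℝ, Integrable fun s => b (s - c) * wave x s := fun c =>
    (b.integrable.comp_sub_right c).mul_bdd (c := 1) (by fun_prop)
      (ae_of_all _ fun s => (norm_wave _ _).le)
  have hexp : ∀ s, (b (s - c) - b (s - (c + t)) + b (s - (c + (M + 1) * t))) * wave x s =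
      b (s - c) * wave x s - b (s - (c + t)) * wave x s +
        b (s - (c + (M + 1) * t)) * wave x s := fun s => by ring
  simp_rw [hexp]
  rw [integral_add ?_ (hi _), integral_sub (hi _) (hi _),
    integral_translates_mul_wave, integral_translates_mul_wave, integral_translates_mul_wave,
    wave_add_right, wave_add_right, trigPoly]
  · ring
  · exact (hi _).sub (hi _)

lemma integral_norm_pow_four_pos {b : SchwartzMap ℝ ℂ} (hb : b 0 ≠ 0) :
    0 < ∫ x, ‖𝓕 b x‖ ^ 4 := by
  have hbi : Integrable fun x => ‖𝓕 b x‖ ^ 4 := by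
    obtain ⟨C, hC⟩ : ∃ C, ∀ x, ‖𝓕 b x‖ ≤ C := by
      obtain ⟨C, hC⟩ := (𝓕 b).decay 0 0
      exact ⟨C, fun x => by simpa using hC.2 x⟩
    have := ((𝓕 b).integrable (μ := volume)).norm.mul_bdd (c := C ^ 3) (g := fun x => ‖𝓕 b x‖ ^ 3)
      ((𝓕 b).continuous.norm.pow 3).aestronglyMeasurable (ae_of_all _ fun x => by
        rw [norm_pow, norm_norm]
        exact pow_le_pow_left₀ (norm_nonneg _) (hC x) 3)
    refine this.congr (ae_of_all _ fun x => ?_)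
    simp only
    ring
  rw [integral_pos_iff_support_of_nonneg (fun x => by positivity) hbi]
  have hopen : IsOpen (Function.support fun x => ‖𝓕 b x‖ ^ 4) := by
    refine Continuous.isOpen_support ?_
    fun_prop
  refine hopen.measure_pos _ ?_
  by_contra hne
  rw [Set.not_nonempty_iff_eq_empty, Function.support_eq_empty_iff] at hne
  have h0 : 𝓕 b = 0 := by
    ext x
    have := congrFun hne x
    simpa using this
  have h1 := integral_fourier_mul_wave b 0
  rw [h0] at h1
  simp at h1
  exact hb h1.symm

/-- A band-limited function that is nonnegative on the lattice but takes a negative value as a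
quadratic form on functions with frequencies in `[-1/2, 1/2]`. -/
lemma exists_lattice_nonneg_form_neg {a : ℝ} (ha : 1 / 2 < a) :
    ∃ (Q : SchwartzMap ℝ ℂ) (f : ℝ → ℝ) (g : ℝ → ℂ),
      (∀ s, Q s ≠ 0 → |s| ≤ 1 / (2 * a)) ∧ (∀ x, 𝓕 Q x = f x) ∧ (∀ k : ℤ, 0 ≤ f (a * k)) ∧
      Continuous g ∧
      ∫ x, f x * ‖∫ t in (-(1 / 2) : ℝ)..(1 / 2), g t * wave x t‖ ^ 2 < 0 := by
  have ha0 : 0 < a := by linarith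
  obtain ⟨M, t, hM, ht, hMt, htB⟩ := exists_dirichlet_parameters (B := 1 / (2 * a))
    (by positivity) (by rw [div_lt_one (by positivity)]; linarith)
  have hat : a * t * (2 * M + 1) = 1 := by
    rw [mul_assoc, htB]
    field_simp
  -- The first bound keeps the Dirichlet frequencies, widened by `2δ`, inside the band, and the
  -- fourfold convolution, of radius `4δ`, below the spacing `t`. The second keeps the three
  -- translates of the bump inside `(-1/2, 1/2)`.
  obtain ⟨δ, hδ, hδ1, hδ2⟩ : ∃ δ : ℝ, 0 < δ ∧ 8 * δ ≤ t ∧ 2 * δ ≤ 1 - (M + 1) * t :=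
    ⟨min (t / 8) ((1 - (M + 1) * t) / 2), lt_min (by positivity) (by linarith),
      by linarith [min_le_left (t / 8) ((1 - (M + 1) * t) / 2)],
      by linarith [min_le_right (t / 8) ((1 - (M + 1) * t) / 2)]⟩
  obtain ⟨b, hb1, hb2, hb3, hb4⟩ := exists_even_bump hδ
  have hw : ∀ x, ((‖𝓕 b x‖ : ℝ) : ℂ) ^ 2 = (𝓕 b x) ^ 2 := fun x => by
    rw [← Complex.mul_conj', conj_fourier_of_even hb2 hb3, sq]
  have hp := selfConv_support hb1
  have hr : ∀ s, selfConv (selfConv b) s ≠ 0 → |s| < t := fun s hs => by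
    linarith [selfConv_support hp s hs]
  set F : ℝ → ℂ := fun s =>
    ∑ i ∈ Finset.range (2 * M + 1), selfConv b (s + ((i : ℝ) - M) * t) with hF
  have hFs : ∀ s, F s ≠ 0 → |s| ≤ 1 / (2 * a) := by
    intro s hs
    obtain ⟨i, hi, hne⟩ := Finset.exists_ne_zero_of_sum_ne_zero hs
    have h1 := abs_lt.1 (hp _ hne)
    have h2 : (i : ℝ) ≤ 2 * M := by
      rw [Finset.mem_range] at hi
      exact_mod_cast (by omega : i ≤ 2 * M)
    have h3 : (0 : ℝ) ≤ i := by positivity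
    rw [abs_le]
    constructor <;> nlinarith
  have hFc : HasCompactSupport F :=
    HasCompactSupport.of_support_subset_isCompact (isCompact_Icc (a := -(1 / (2 * a)))
      (b := 1 / (2 * a))) fun s hs => abs_le.1 (hFs s hs)
  have hFd : ContDiff ℝ ∞ F := by
    refine ContDiff.sum fun i _ => ?_
    exact (selfConv b).smooth'.comp (contDiff_id.add contDiff_const)
  set f : ℝ → ℝ := fun x => (dirichlet M t x).re * ‖𝓕 b x‖ ^ 2 with hf
  have hfc : ∀ x, (f x : ℂ) = dirichlet M t x * (𝓕 b x) ^ 2 := fun x => by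
    rw [hf]
    push_cast
    rw [ofReal_re_dirichlet, hw]
  -- Centres the span `[c, c + (M+1)t]` of the three translates at the origin.
  set c : ℝ := -((M + 1) * t / 2) with hc
  set g : ℝ → ℂ := fun s => b (s - c) - b (s - (c + t)) + b (s - (c + (M + 1) * t)) with hg
  have hgs : ∀ s, g s ≠ 0 → |s| < 1 / 2 := by
    intro s hs
    have hM0 : (0 : ℝ) ≤ M * t := by positivity
    by_contra hlt
    have key : ∀ y, |y| ≤ (M + 1) * t / 2 → b (s - y) = 0 := by
      intro y hy
      by_contra hne
      have h1 := hb1 _ hne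
      have h2 := abs_sub_abs_le_abs_sub s y
      exact hlt (by linarith)
    refine hs ?_
    rw [hg]
    simp only
    rw [key, key, key]
    · simp
    · rw [abs_le]; constructor <;> linarith
    · rw [abs_le]; constructor <;> linarith
    · rw [abs_le]; constructor <;> linarith
  refine ⟨hFc.toSchwartzMap hFd, f, g, hFs, fun x => ?_, fun k => ?_, by fun_prop, ?_⟩
  · rw [SchwartzMap.fourier_coe, hfc, ← fourier_selfConv]
    exact fourier_sum_translate _ _ _ _
  · exact mul_nonneg (dirichlet_lattice_nonneg hat k) (by positivity)
  · have h1 : ∀ x, ((f x * ‖∫ s in (-(1 / 2) : ℝ)..(1 / 2), g s * wave x s‖ ^ 2 : ℝ) : ℂ) =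
        𝓕 (selfConv (selfConv b)) x * dirichlet M t x *
          (trigPoly M t x * (starRingEnd ℂ) (trigPoly M t x)) := by
      intro x
      have h2 : wave x c * (starRingEnd ℂ) (wave x c) = 1 := by
        rw [Complex.mul_conj', norm_wave]; simp
      rw [setIntegral_eq_integral_mul_wave hgs, hg, integral_three_translates,
        integral_mul_wave_of_even hb2]
      push_cast
      rw [hfc, ← Complex.mul_conj', map_mul, map_mul, conj_fourier_of_even hb2 hb3,
        fourier_selfConv, fourier_selfConv]
      linear_combination (dirichlet M t x * (𝓕 b x) ^ 4 *
        (trigPoly M t x * (starRingEnd ℂ) (trigPoly M t x))) * h2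
    have h3 : ((∫ x, f x * ‖∫ s in (-(1 / 2) : ℝ)..(1 / 2), g s * wave x s‖ ^ 2 : ℝ) : ℂ) =
        ((-∫ x, ‖𝓕 b x‖ ^ 4 : ℝ) : ℂ) := by
      rw [← integral_complex_ofReal]
      simp_rw [h1]
      rw [integral_dirichlet_mul_trigPoly ht hr hM, ← integral_fourier_mul_wave,
        Complex.ofReal_neg, ← integral_complex_ofReal]
      congr 1
      refine integral_congr_ae (ae_of_all _ fun x => ?_)
      simp only
      rw [wave_zero, mul_one, fourier_selfConv, fourier_selfConv, ← hw]
      push_cast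
      ring
    rw [Complex.ofReal_injective h3]
    linarith [integral_norm_pow_four_pos hb4]

end Obstruction

/-! ### Product test functions and necessity -/

section Necessity

open scoped ContDiff

lemma fourier_prod {n : ℕ} (Q : ℝ → ℂ) (x : EuclideanSpace ℝ (Fin n)) :
    𝓕 (fun ξ : EuclideanSpace ℝ (Fin n) => ∏ i, Q (ξ i)) x = ∏ i, 𝓕 Q (x i) := by
  rw [Real.fourier_eq']
  have h1 := (EuclideanSpace.volume_preserving_symm_measurableEquiv_toLp (Fin n)).integral_comp'
    (fun y : Fin n → ℝ => ∏ i, wave (x i) (-(y i)) * Q (y i))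
  simp_rw [fourier_eq_wave]
  rw [← integral_fintype_prod_volume_eq_prod (fun i s => wave (x i) (-s) * Q s), ← h1]
  refine integral_congr_ae (ae_of_all _ fun ξ => ?_)
  simp only [smul_eq_mul]
  rw [Finset.prod_mul_distrib]
  congr 1
  simp only [wave]
  rw [← Complex.exp_sum, ← Finset.sum_mul]
  congr 2
  rw [← Complex.ofReal_sum]
  congr 1
  rw [PiLp.inner_apply, Finset.mul_sum]
  refine Finset.sum_congr rfl fun i _ => ?_
  simp only [RCLike.inner_apply, conj_trivial, MeasurableEquiv.toLp_symm_apply]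
  ring

/-- The Fourier transform of a product of one-dimensional band-limited functions. -/
lemma exists_schwartz_prod {n : ℕ} {Q : SchwartzMap ℝ ℂ} {B : ℝ}
    (hB : ∀ s, Q s ≠ 0 → |s| ≤ B) :
    ∃ η : SchwartzMap (EuclideanSpace ℝ (Fin n)) ℂ, (∀ x, η x = ∏ i, 𝓕 Q (x i)) ∧
      Function.support (𝓕 (η : EuclideanSpace ℝ (Fin n) → ℂ)) ⊆
        {ξ | ∀ i, ξ i ∈ Set.Icc (-B) B} := by
  set F : EuclideanSpace ℝ (Fin n) → ℂ := fun ξ => ∏ i, Q (ξ i) with hF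
  have hsupp : ∀ ξ, F ξ ≠ 0 → ∀ i, ξ i ∈ Set.Icc (-B) B := fun ξ hξ i =>
    abs_le.1 (hB _ (Finset.prod_ne_zero_iff.1 hξ i (Finset.mem_univ i)))
  have hcs : HasCompactSupport F := by
    refine HasCompactSupport.of_support_subset_isCompact
      (K := (MeasurableEquiv.toLp 2 (Fin n → ℝ)) '' Set.pi Set.univ fun _ => Set.Icc (-B) B)
      ((isCompact_univ_pi fun _ => isCompact_Icc).image (PiLp.continuous_toLp 2 _)) ?_
    intro ξ hξ
    exact ⟨WithLp.ofLp ξ, fun i _ => hsupp ξ hξ i, rfl⟩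
  have hsm : ContDiff ℝ ∞ F := by
    refine contDiff_prod fun i _ => Q.smooth'.comp ?_
    fun_prop
  refine ⟨𝓕 (hcs.toSchwartzMap hsm), fun x => ?_, fun ξ hξ => ?_⟩
  · rw [SchwartzMap.fourier_coe]
    exact fourier_prod Q x
  -- Applying `𝓕` twice reflects `F`; the cube is symmetric, so the support condition is unaffected.
  · have h1 : 𝓕 ((𝓕 (hcs.toSchwartzMap hsm) : SchwartzMap _ ℂ) : EuclideanSpace ℝ (Fin n) → ℂ) ξ =
        F (-ξ) := by
      have h2 := Real.fourierInv_eq_fourier_neg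
        ((𝓕 (hcs.toSchwartzMap hsm) : SchwartzMap _ ℂ) : EuclideanSpace ℝ (Fin n) → ℂ) (-ξ)
      rw [neg_neg] at h2
      rw [← h2, ← SchwartzMap.fourierInv_coe, FourierTransform.fourierInv_fourier_eq]
      rfl
    have h3 := hsupp (-ξ) (h1 ▸ hξ)
    intro i
    have h4 := h3 i
    simp only [PiLp.neg_apply, Set.mem_Icc] at h4 ⊢
    constructor <;> linarith

lemma SupportedOnLattice.exists_integral_distinctSum {v : PointProcess} {a : ℝ}
    (hv : SupportedOnLattice v a) {f : ℝ → ℝ} (hf : ∀ k : ℤ, 0 ≤ f (a * k)) {n : ℕ}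
    {φ : EuclideanSpace ℝ (Fin n) → ℂ} (hφ : ∀ x, φ x = ((∏ i, f (x i) : ℝ) : ℂ)) :
    ∃ y : ℝ, 0 ≤ y ∧ ∫ u, distinctSum φ u ∂(v : Measure Configuration) = y := by
  -- No summability or integrability is required: the default value `0` of a sum or an integral is
  -- also nonnegative, and casting from `ℝ` to `ℂ` commutes with both in every case.
  refine ⟨∫ u, ∑' j : Fin n ↪ Configuration.Index u, ∏ i, f (j i).1 ∂(v : Measure Configuration),
    integral_nonneg_of_ae ?_, ?_⟩
  · filter_upwards [hv] with u hu
    refine tsum_nonneg fun j => Finset.prod_nonneg fun i _ => ?_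
    obtain ⟨k, hk⟩ := hu (j i).1 (Fin.pos (j i).2).ne'
    rw [hk]
    exact hf k
  · rw [← integral_complex_ofReal]
    refine integral_congr_ae (ae_of_all _ fun u => ?_)
    simp only [distinctSum, hφ, Complex.ofReal_tsum]

theorem le_half_of_lattice_mimicry {z : PointProcess} (hz : IsSineProcess z) {a : ℝ}
    {v : PointProcess} (hv : SupportedOnLattice v a) (hm : Mimics v z (1 / (2 * a))) :
    a ≤ 1 / 2 := by
  by_contra! ha
  obtain ⟨Q, f, g, hQs, hf, hfa, hg, hneg⟩ := exists_lattice_nonneg_form_neg ha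
  have hfi : Integrable f := by
    refine (𝓕 Q).integrable.re.congr (ae_of_all _ fun x => ?_)
    simp [hf]
  obtain ⟨n, hn, hlt⟩ := exists_integral_sineDet_neg hfi hg hneg
  obtain ⟨η, hη, hηs⟩ := exists_schwartz_prod (n := n) hQs
  have hη' : ∀ x, η x = ((∏ i, f (x i) : ℝ) : ℂ) := fun x => by
    rw [hη, Complex.ofReal_prod]
    exact Finset.prod_congr rfl fun i _ => hf _
  obtain ⟨y, hy, hvy⟩ := hv.exists_integral_distinctSum hfa hη'
  have h1 := hm.correlations_eq n hn η hηs
  have h2 := (EuclideanSpace.volume_preserving_symm_measurableEquiv_toLp (Fin n)).integral_comp'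
    (fun x : Fin n → ℝ => (∏ i, f (x i)) * sineDet (WithLp.toLp 2 x))
  rw [hvy, hz.integral_distinctSum hn η.continuous η.integrable] at h1
  have h3 : ∫ x, η x * (sineDet x : ℂ) =
      ((∫ x : Fin n → ℝ, (∏ i, f (x i)) * sineDet (WithLp.toLp 2 x) : ℝ) : ℂ) := by
    rw [← h2, ← integral_complex_ofReal]
    refine integral_congr_ae (ae_of_all _ fun x => ?_)
    simp only [hη', Complex.ofReal_mul]
    rfl
  rw [h3] at h1
  linarith [Complex.ofReal_injective h1]

end Necessity

end

end BandLimitedMimicry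

theorem mainTheorem2 (z : BandLimitedMimicry.PointProcess)
    (hz : BandLimitedMimicry.IsSineProcess z) (a : ℝ) (ha : 0 < a) :
    (∃ v : BandLimitedMimicry.PointProcess,
      BandLimitedMimicry.UniformLocalMoments v ∧
      BandLimitedMimicry.SupportedOnLattice v a ∧
      BandLimitedMimicry.Mimics v z (1 / (2 * a))) ↔ a ≤ 1 / 2 :=
  ⟨fun ⟨_, _, hv, hm⟩ => BandLimitedMimicry.le_half_of_lattice_mimicry hz hv hm,
    BandLimitedMimicry.exists_lattice_mimicry hz ha⟩
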